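/- Let $(\mathbf I,\Omega,{}',{}'')$ be a finite oriented graph (loops and multiple edges allowed; $h'$ and $h''$ are the source and target of the edge $h$) with an admissible automorphism $a$: compatible bijections of $\mathbf I$ and $\Omega$ such that no edge $h$ with $h'\ne h''$ has both ends in one $a$-orbit of vertices. For a vertex $i$ let $[i]$ be its orbit and $I=\mathbf I/a$. Let $e\in\Omega$, $[i_+]=[e']$, $[i_-]=[e'']$, and assume: (1) $\#[i_+]=\#[i_-]=:\phi$; (2) if $h',h''\in[i_+]\cup[i_-]$ and $h'\neq h''$, there is no edge $l$ with $l',l''\in[i_+]\cup[i_-]$, $l'\in\{h',h''\}$ and $l''\notin\{h',h''\}$; (3) there are no loops at vertices of $[i_+]\cup[i_-]$; (4) $a^{\phi}(e)=e$. Several edges may join $[i_+]$ and $[i_-]$. Put $h_k=a^k(e)$ for $1\le k\le\phi$. The contracted graph has vertex set $\widehat{\mathbf I}=\mathbf I\setminus[i_-]$ and as edges: the edges of $\Omega$ with no end in $[i_-]$; an edge $l h_k$ from $h_k'$ to $l''$ for each edge $l$ with $l'=h_k''$; and an edge $\overline{h_k}\,l$ from $l'$ to $h_k'$ for each edge $l\ne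 h_k$ with $l''=h_k''$. It carries the admissible automorphism induced by $a$. Let $\widehat I$ be its set of orbits of vertices; write $i_0\in\widehat I$ for the orbit $[i_+]$, and embed $\mathbb N[\widehat I]$ into $\mathbb N[I]$ by $i_0\mapsto i_++i_-$. Let $q=p^n$ with $p$ prime and $n\ge1$, $K=\overline{\mathbb F}_p$, and fix $q^{1/2}\in\mathbb C$ with square $q$. For $\nu\in\mathbb N[I]$ let $V_i=K^{\nu_{[i]}}$, $E_\nu=\bigoplus_{h\in\Omega}\operatorname{Hom}(V_{h'},V_{h''})$, $G_\nu=\prod_{i\in\mathbf I} GL(V_i)$, acting by $(g.x)_h=g_{h''}x_hg_{h'}^{-1}$, and let $F$ be the twisted Frobenius on these: $F(x)_h$ is $x_{a(h)}$, and $F(g)_i$ is $g_{a(i)}$, with all entries raised to the power $q$. Let $\mathbf H_\nu$ be the space of $G_\nu^F$-invariant functions $E_\nu^F\to\mathbb Q(q^{1/2})$, and let $\mathbf H_\Omega=\bigoplus_{\nu\in\mathbb N[I]}\mathbf H_\nu$ be the Hall algebra, with multiplication given for $f_1\in\mathbf H_\tau$, $f_2\in\mathbf H_\omega$ by $$f_1\circ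 f_2=(q^{1/2})^{-m_\Omega(\tau,\omega)}\,\frac{1}{\#(G_\tau^F\times G_\omega^F)}\,(p_3)_!(p_2)_!(p_1)^*(f_1\otimes f_2)\in\mathbf H_{\tau+\omega},\qquad m_\Omega(\tau,\omega)=\sum_{i\in\mathbf I}\tau_i\omega_i+\sum_{h\in\Omega}\tau_{h'}\omega_{h''}.$$ Here $E_\tau^F\times E_\omega^F\xleftarrow{p_1}E'^F\xrightarrow{p_2}E''^F\xrightarrow{p_3}E_{\tau+\omega}^F$ is the $F$-fixed part of Lusztig's induction diagram: writing $V=T\oplus W$ with $T,W$ of dimension vectors $\tau,\omega$, let $S_W\subseteq E_{\tau+\omega}$ be the set of $x$ that leave $W$ invariant; $E'$ and $E''$ are the sets of orbits in $G_{\tau+\omega}\times S_W$ of the unipotent radical of the stabilizer of $W$ and of that stabilizer itself, acting by $b.(g,x)=(gb^{-1},b.x)$; $p_1[g,x]=(x|_{V/W},x|_W)$, $p_2[g,x]=[g,x]$, $p_3[g,x]=g.x$; and $\phi_!$ is summation over the fibres of $\phi$. The unit is the function $1\in\mathbf H_0$. Let $\mathbf H_{\widehat\Omega}=\bigoplus_{\nu\in\mathbb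 N[\widehat I]}\mathbf H_{\nu,\widehat\Omega}$ be the Hall algebra of the contracted graph. For $\nu\in\mathbb N[\widehat I]\subseteq\mathbb N[I]$ let $E_\nu^{\heartsuit}\subseteq E_\nu$ be the set of $x$ with all $x_{h_k}$ isomorphisms, and let $\mu_\nu:E_\nu^{\heartsuit,F}\to\widehat E_\nu^{F}$ be the contraction map $\widehat x_h=x_h$, $\widehat x_{l h_k}=x_lx_{h_k}$, $\widehat x_{\overline{h_k}l}=x_{h_k}^{-1}x_l$. Let $\mathbf H^{\heartsuit}_\Omega$ be the direct sum over $\nu\in\mathbb N[\widehat I]$ of the spaces of $G_\nu^F$-invariant functions $E_\nu^{\heartsuit,F}\to\mathbb Q(q^{1/2})$. Let $\mu^\star:\mathbf H_{\widehat\Omega}\to\mathbf H^{\heartsuit}_\Omega$ be given on the $\nu$-component by $\mu_\nu^\star(f)=(q^{-1/2})^{\nu_{i_-}^2\phi}\,f\circ\mu_\nu$, and let $j_!:\mathbf H^{\heartsuit}_\Omega\to\mathbf H_\Omega$ be extension by zero. Then $\psi=j_!\circ\mu^\star:\mathbf H_{\widehat\Omega}\to\mathbf H_\Omega$ is an injective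 homomorphism of algebras over $\mathbb Q(q^{1/2})$: it is linear and injective, $\psi(1)=1$, and $\psi(f\circ g)=\psi(f)\circ\psi(g)$ for all $f,g$. -/

import Mathlib

open scoped DirectSum

noncomputable section


namespace HallContraction

/-! ### Oriented graphs with an admissible automorphism -/

/-- An oriented graph with vertex set `ι` and edge set `Ω` (loops and multiple edges are allowed),
`src h = h'`, `tgt h = h''`, together with an admissible automorphism `a = (aV, aE)`: an edge that
is not a loop never has both its ends in one `a`-orbit of vertices. -/
structure AdmissibleQuiver (ι Ω : Type*) where
  src : Ω → ι
  tgt : Ω → ι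
  aV : Equiv.Perm ι
  aE : Equiv.Perm Ω
  src_aE : ∀ h, src (aE h) = aV (src h)
  tgt_aE : ∀ h, tgt (aE h) = aV (tgt h)
  admissible : ∀ h, src h ≠ tgt h → ¬ aV.SameCycle (src h) (tgt h)

namespace AdmissibleQuiver

variable {ι Ω : Type*} (Q : AdmissibleQuiver ι Ω)

/-- The `a`-orbit `[i]` of a vertex. -/
def orbit (i : ι) : Set ι := {j | Q.aV.SameCycle i j}

/-- The number of vertices of the orbit `[i]`. -/
def φ₁ (i : ι) : ℕ := Nat.card (Q.orbit i)

/-- The number of loops at `i`; it depends only on the orbit of `i`. -/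
def φ₂ (i : ι) : ℕ := Nat.card {h : Ω // Q.src h = i ∧ Q.tgt h = i}

/-- The set `I` of `a`-orbits of vertices. -/
def Orb : Type _ := Quotient (Equiv.Perm.SameCycle.setoid Q.aV)

/-- The orbit of `i` as an element of `I`. -/
def orb (i : ι) : Q.Orb := Quotient.mk (Equiv.Perm.SameCycle.setoid Q.aV) i

/-- Dimension vectors, the elements of `ℕ[I]`. -/
abbrev Dim : Type _ := Q.Orb → ℕ

/-- `e` is an edge along whose orbit one can contract: with `[i₊] = [e']` and `[i₋] = [e'']`, the
two orbits have the same size, they carry no loops, the edges inside `[i₊] ∪ [i₋]` only join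
matched vertices, and the edges `h_k = a^k(e)`, `1 ≤ k ≤ φ₁(i₊)`, form an orbit of `a` (so that
`a` acts on the contracted graph). -/
structure IsContractible (e : Ω) : Prop where
  card_eq : Q.φ₁ (Q.src e) = Q.φ₁ (Q.tgt e)
  matched : ∀ h : Ω, Q.src h ∈ Q.orbit (Q.src e) ∪ Q.orbit (Q.tgt e) →
    Q.tgt h ∈ Q.orbit (Q.src e) ∪ Q.orbit (Q.tgt e) → Q.src h ≠ Q.tgt h →
    ¬ ∃ l : Ω, Q.src l ∈ Q.orbit (Q.src e) ∪ Q.orbit (Q.tgt e) ∧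
      Q.tgt l ∈ Q.orbit (Q.src e) ∪ Q.orbit (Q.tgt e) ∧
      (Q.src l = Q.src h ∨ Q.src l = Q.tgt h) ∧ ¬ (Q.tgt l = Q.src h ∨ Q.tgt l = Q.tgt h)
  loops_src : Q.φ₂ (Q.src e) = 0
  loops_tgt : Q.φ₂ (Q.tgt e) = 0
  pow_fix : (Q.aE ^ Q.φ₁ (Q.src e)) e = e

theorem src_zpow (k : ℤ) (h : Ω) : Q.src ((Q.aE ^ k) h) = (Q.aV ^ k) (Q.src h) := by
  induction k using Int.induction_on generalizing h with
  | zero => simp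
  | succ k ih => rw [zpow_add_one, zpow_add_one, Equiv.Perm.mul_apply, ih, Q.src_aE]; rfl
  | pred k ih =>
    rw [zpow_sub_one, zpow_sub_one, Equiv.Perm.mul_apply, ih, Equiv.Perm.mul_apply]
    congr 1
    rw [Equiv.Perm.eq_inv_iff_eq, ← Q.src_aE]; simp

theorem tgt_zpow (k : ℤ) (h : Ω) : Q.tgt ((Q.aE ^ k) h) = (Q.aV ^ k) (Q.tgt h) := by
  induction k using Int.induction_on generalizing h with
  | zero => simp
  | succ k ih => rw [zpow_add_one, zpow_add_one, Equiv.Perm.mul_apply, ih, Q.tgt_aE]; rfl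
  | pred k ih =>
    rw [zpow_sub_one, zpow_sub_one, Equiv.Perm.mul_apply, ih, Equiv.Perm.mul_apply]
    congr 1
    rw [Equiv.Perm.eq_inv_iff_eq, ← Q.tgt_aE]; simp

theorem orb_src_aE (h : Ω) : Q.orb (Q.src (Q.aE h)) = Q.orb (Q.src h) := by
  rw [Q.src_aE]
  exact Quotient.sound (Equiv.Perm.sameCycle_apply_left.2 (Equiv.Perm.SameCycle.refl _ _))

theorem orb_tgt_aE (h : Ω) : Q.orb (Q.tgt (Q.aE h)) = Q.orb (Q.tgt h) := by
  rw [Q.tgt_aE]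
  exact Quotient.sound (Equiv.Perm.sameCycle_apply_left.2 (Equiv.Perm.SameCycle.refl _ _))

theorem orb_aV (i : ι) : Q.orb (Q.aV i) = Q.orb i :=
  Quotient.sound (Equiv.Perm.sameCycle_apply_left.2 (Equiv.Perm.SameCycle.refl _ _))

/-! ### The contracted graph -/

theorem exists_leg (e : Ω) {i : ι} (hi : i ∈ Q.orbit (Q.tgt e)) :
    ∃ h, Q.aE.SameCycle e h ∧ Q.tgt h = i := by
  obtain ⟨k, hk⟩ := hi
  exact ⟨(Q.aE ^ k) e, ⟨k, rfl⟩, by rw [Q.tgt_zpow, hk]⟩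

/-- For `i ∈ [i₋]`, the contracted edge `h_k` with `h_k'' = i`. -/
def leg (e : Ω) {i : ι} (hi : i ∈ Q.orbit (Q.tgt e)) : Ω := (Q.exists_leg e hi).choose

theorem leg_sameCycle (e : Ω) {i : ι} (hi : i ∈ Q.orbit (Q.tgt e)) :
    Q.aE.SameCycle e (Q.leg e hi) := (Q.exists_leg e hi).choose_spec.1

theorem tgt_leg (e : Ω) {i : ι} (hi : i ∈ Q.orbit (Q.tgt e)) :
    Q.tgt (Q.leg e hi) = i := (Q.exists_leg e hi).choose_spec.2

/-- The vertices of the contracted graph: all vertices outside `[i₋]`. -/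
abbrev CVertex (e : Ω) : Type _ := {i : ι // i ∉ Q.orbit (Q.tgt e)}

/-- The edges of the contracted graph: all edges except the contracted ones `h_k`. An edge `l` with
no end in `[i₋]` is kept; one with `l' ∈ [i₋]` stands for `l h_k`, where `h_k'' = l'`; one with
`l'' ∈ [i₋]` stands for `h_k⁻¹ l`, where `h_k'' = l''`. -/
abbrev CEdge (e : Ω) : Type _ := {l : Ω // ¬ Q.aE.SameCycle e l}

section contraction

variable {Q}
variable [Finite ι] [Finite Ω] {e : Ω}

theorem src_ne_of_loops {i j : ι} (h0 : Q.φ₂ i = 0) (hj : j ∈ Q.orbit i) (h : Ω)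
    (hs : Q.src h = j) : Q.tgt h ≠ j := by
  intro ht
  obtain ⟨k, hk⟩ := hj
  have hE : IsEmpty {h : Ω // Q.src h = i ∧ Q.tgt h = i} := Finite.card_eq_zero_iff.1 h0
  refine hE.false ⟨(Q.aE ^ (-k)) h, ?_, ?_⟩
  · rw [Q.src_zpow, hs, ← hk, ← Equiv.Perm.mul_apply, ← zpow_add]; simp
  · rw [Q.tgt_zpow, ht, ← hk, ← Equiv.Perm.mul_apply, ← zpow_add]; simp

theorem IsContractible.src_ne_tgt (hC : Q.IsContractible e) {h : Ω} (hh : Q.aE.SameCycle e h) :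
    Q.src h ≠ Q.tgt h := by
  obtain ⟨k, rfl⟩ := hh
  have : Q.src ((Q.aE ^ k) e) ∈ Q.orbit (Q.src e) := ⟨k, (Q.src_zpow k e).symm⟩
  exact (src_ne_of_loops hC.loops_src this _ rfl).symm

theorem src_mem {h : Ω} (hh : Q.aE.SameCycle e h) : Q.src h ∈ Q.orbit (Q.src e) := by
  obtain ⟨k, rfl⟩ := hh
  exact ⟨k, (Q.src_zpow k e).symm⟩

theorem tgt_mem {h : Ω} (hh : Q.aE.SameCycle e h) : Q.tgt h ∈ Q.orbit (Q.tgt e) := by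
  obtain ⟨k, rfl⟩ := hh
  exact ⟨k, (Q.tgt_zpow k e).symm⟩

theorem IsContractible.disjoint (hC : Q.IsContractible e) {i : ι} (hi : i ∈ Q.orbit (Q.src e)) :
    i ∉ Q.orbit (Q.tgt e) := fun h =>
  Q.admissible e (hC.src_ne_tgt (Equiv.Perm.SameCycle.refl _ _)) (hi.trans h.symm)

theorem IsContractible.fix_of_tgt (hC : Q.IsContractible e) (k : ℤ)
    (hk : (Q.aV ^ k) (Q.tgt e) = Q.tgt e) : (Q.aE ^ k) e = e := by
  have hc : Q.φ₁ (Q.tgt e) = Function.minimalPeriod Q.aV (Q.tgt e) := by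
    have h1 : Q.orbit (Q.tgt e) = MulAction.orbit (Subgroup.zpowers Q.aV) (Q.tgt e) := by
      ext j
      constructor
      · rintro ⟨k, hk⟩
        exact ⟨⟨Q.aV ^ k, k, rfl⟩, hk⟩
      · rintro ⟨⟨_, k, rfl⟩, hk⟩
        exact ⟨k, hk⟩
    have := Fintype.ofFinite ι
    have : Fintype (MulAction.orbit (Subgroup.zpowers Q.aV) (Q.tgt e)) := Fintype.ofFinite _
    rw [φ₁, h1, Nat.card_eq_fintype_card, ← MulAction.minimalPeriod_eq_card]
    rfl
  have hd : (Q.φ₁ (Q.src e) : ℤ) ∣ k := by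
    rw [hC.card_eq, hc]
    exact (MulAction.zpow_smul_eq_iff_minimalPeriod_dvd (a := Q.aV) (b := Q.tgt e)).1 hk
  obtain ⟨m, rfl⟩ := hd
  have h2 : (Q.aE ^ (Q.φ₁ (Q.src e) : ℤ)) e = e := by
    rw [zpow_natCast]; exact hC.pow_fix
  rw [zpow_mul]
  exact Function.IsFixedPt.perm_zpow h2 m

theorem IsContractible.eq_of_tgt (hC : Q.IsContractible e) {h l : Ω} (hh : Q.aE.SameCycle e h)
    (hl : Q.aE.SameCycle e l) (ht : Q.tgt h = Q.tgt l) : h = l := by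
  obtain ⟨j, rfl⟩ := hh
  obtain ⟨k, rfl⟩ := hl
  rw [Q.tgt_zpow, Q.tgt_zpow] at ht
  have h1 : (Q.aV ^ (-k + j)) (Q.tgt e) = Q.tgt e := by
    rw [zpow_add, Equiv.Perm.mul_apply, ht, ← Equiv.Perm.mul_apply, ← zpow_add]; simp
  have h2 := hC.fix_of_tgt _ h1
  have h3 : (Q.aE ^ k) ((Q.aE ^ (-k + j)) e) = (Q.aE ^ k) e := by rw [h2]
  rw [← Equiv.Perm.mul_apply, ← zpow_add] at h3
  simpa using h3

open Classical in
/-- The map of vertices that identifies `h_k'' ∈ [i₋]` with `h_k' ∈ [i₊]`. -/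
def fold (hC : Q.IsContractible e) (i : ι) : Q.CVertex e :=
  if hi : i ∈ Q.orbit (Q.tgt e) then
    ⟨Q.src (Q.leg e hi), hC.disjoint (src_mem (Q.leg_sameCycle e hi))⟩
  else ⟨i, hi⟩

theorem fold_of_mem (hC : Q.IsContractible e) {i : ι} (hi : i ∈ Q.orbit (Q.tgt e)) :
    (fold hC i).1 = Q.src (Q.leg e hi) := by
  rw [fold, dif_pos hi]

theorem fold_of_notMem (hC : Q.IsContractible e) {i : ι} (hi : i ∉ Q.orbit (Q.tgt e)) :
    (fold hC i).1 = i := by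
  rw [fold, dif_neg hi]

theorem aV_mem_orbit {i j : ι} : Q.aV j ∈ Q.orbit i ↔ j ∈ Q.orbit i :=
  Equiv.Perm.sameCycle_apply_right

theorem IsContractible.leg_aV (hC : Q.IsContractible e) {i : ι} (hi : i ∈ Q.orbit (Q.tgt e))
    (hi' : Q.aV i ∈ Q.orbit (Q.tgt e)) : Q.leg e hi' = Q.aE (Q.leg e hi) := by
  refine hC.eq_of_tgt (Q.leg_sameCycle e hi')
    (Equiv.Perm.sameCycle_apply_right.2 (Q.leg_sameCycle e hi)) ?_
  rw [Q.tgt_leg, Q.tgt_aE, Q.tgt_leg]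

theorem fold_aV (hC : Q.IsContractible e) (i : ι) : (fold hC (Q.aV i)).1 = Q.aV (fold hC i).1 := by
  by_cases hi : i ∈ Q.orbit (Q.tgt e)
  · rw [fold_of_mem hC hi, fold_of_mem hC (aV_mem_orbit.2 hi), hC.leg_aV hi, Q.src_aE]
  · rw [fold_of_notMem hC hi, fold_of_notMem hC (fun h => hi (aV_mem_orbit.1 h))]

/-- The contracted graph with its admissible automorphism, the restriction of `a`. -/
def contract (hC : Q.IsContractible e) : AdmissibleQuiver (Q.CVertex e) (Q.CEdge e) where
  src l := fold hC (Q.src l.1)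
  tgt l := fold hC (Q.tgt l.1)
  aV := Q.aV.subtypePerm (fun _ => not_congr aV_mem_orbit)
  aE := Q.aE.subtypePerm (fun _ => not_congr Equiv.Perm.sameCycle_apply_right)
  src_aE l := Subtype.ext <| by
    show (fold hC (Q.src (Q.aE l.1))).1 = Q.aV (fold hC (Q.src l.1)).1
    rw [Q.src_aE, fold_aV]
  tgt_aE l := Subtype.ext <| by
    show (fold hC (Q.tgt (Q.aE l.1))).1 = Q.aV (fold hC (Q.tgt l.1)).1
    rw [Q.tgt_aE, fold_aV]
  admissible l hne hs := by
    rw [Equiv.Perm.sameCycle_subtypePerm] at hs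
    by_cases h1 : Q.src l.1 ∈ Q.orbit (Q.tgt e) <;> by_cases h2 : Q.tgt l.1 ∈ Q.orbit (Q.tgt e)
    · by_cases h3 : Q.src l.1 = Q.tgt l.1
      · exact hne (by rw [h3])
      · exact Q.admissible _ h3 (h1.symm.trans h2)
    · rw [fold_of_mem hC h1, fold_of_notMem hC h2] at hs
      have hk := Q.leg_sameCycle e h1
      refine hC.matched (Q.leg e h1) (Or.inl (src_mem hk)) (Or.inr (tgt_mem hk))
        (hC.src_ne_tgt hk) ⟨l.1, Or.inr h1, Or.inl ((src_mem hk).trans hs),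
          Or.inr (Q.tgt_leg e h1).symm, ?_⟩
      rintro (h | h)
      · exact hne (Subtype.ext (by rw [fold_of_mem hC h1, fold_of_notMem hC h2, h]))
      · exact h2 (h ▸ tgt_mem hk)
    · rw [fold_of_notMem hC h1, fold_of_mem hC h2] at hs
      have hk := Q.leg_sameCycle e h2
      have hl : Q.src l.1 ∈ Q.orbit (Q.src e) := (src_mem hk).trans hs.symm
      obtain ⟨m, hm⟩ := hl
      have hm' : Q.aE.SameCycle e ((Q.aE ^ m) e) := ⟨m, rfl⟩
      have hsm : Q.src l.1 = Q.src ((Q.aE ^ m) e) := by rw [Q.src_zpow, hm]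
      refine hC.matched ((Q.aE ^ m) e) (Or.inl (src_mem hm')) (Or.inr (tgt_mem hm'))
        (hC.src_ne_tgt hm') ⟨l.1, Or.inl (hsm ▸ src_mem hm'), Or.inr h2, Or.inl hsm, ?_⟩
      rintro (h | h)
      · exact hC.disjoint (h ▸ src_mem hm') h2
      · have := hC.eq_of_tgt hk hm' (by rw [Q.tgt_leg, h])
        exact hne (Subtype.ext (by rw [fold_of_notMem hC h1, fold_of_mem hC h2, this, hsm]))
    · rw [fold_of_notMem hC h1, fold_of_notMem hC h2] at hs
      refine Q.admissible _ (fun h => hne (by rw [h])) hs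

theorem fold_sameCycle (hC : Q.IsContractible e) (k : ℤ) (i : ι) :
    Q.aV.SameCycle (fold hC i).1 (fold hC ((Q.aV ^ k) i)).1 := by
  induction k using Int.induction_on generalizing i with
  | zero => exact Equiv.Perm.SameCycle.refl _ _
  | succ k ih =>
    have := ih (Q.aV i)
    rw [fold_aV, Equiv.Perm.sameCycle_apply_left] at this
    rwa [zpow_add_one]
  | pred k ih =>
    have := ih (Q.aV⁻¹ i)
    have h1 : Q.aV (Q.aV⁻¹ i) = i := by simp
    rw [← Equiv.Perm.sameCycle_apply_left, ← fold_aV, h1] at this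
    rwa [zpow_sub_one]

/-- The map `I → Î` of sets of orbits; it sends both `i₊` and `i₋` to `i₀`. -/
def foldOrb (hC : Q.IsContractible e) : Q.Orb → (contract hC).Orb :=
  Quotient.lift (fun i => (contract hC).orb (fold hC i)) fun i _ hij => by
    obtain ⟨k, rfl⟩ := hij
    exact Quotient.sound ((Equiv.Perm.sameCycle_subtypePerm (f := Q.aV)
      (p := fun i => i ∉ Q.orbit (Q.tgt e)) (h := fun _ => not_congr aV_mem_orbit)).2
        (fold_sameCycle hC k i))

/-- The inclusion `ℕ[Î] → ℕ[I]`, `i₀ ↦ i₊ + i₋`. -/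
def extDim (hC : Q.IsContractible e) (ν : (contract hC).Dim) : Q.Dim := fun i => ν (foldOrb hC i)

end contraction

/-! ### Representation spaces and the twisted Frobenius -/

/-- Renaming of the index sets of a matrix along equalities of their sizes. -/
def castM {K : Type*} {m n m' n' : ℕ} (hm : m' = m) (hn : n' = n)
    (A : Matrix (Fin m) (Fin n) K) : Matrix (Fin m') (Fin n') K :=
  A.submatrix (Fin.cast hm) (Fin.cast hn)

section castM

variable {K : Type*} [Field K]

theorem castM_mul {m n l m' n' l' : ℕ} (hm : m' = m) (hn : n' = n) (hl : l' = l)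
    (A : Matrix (Fin m) (Fin n) K) (B : Matrix (Fin n) (Fin l) K) :
    castM hm hl (A * B) = castM hm hn A * castM hn hl B := by
  subst hm hn hl; rfl

theorem castM_one {m m' : ℕ} (h h' : m' = m) :
    castM h h' (1 : Matrix (Fin m) (Fin m) K) = 1 := by
  subst h; rfl

theorem castM_inv {m m' : ℕ} (h h' : m' = m) (A : Matrix (Fin m) (Fin m) K) :
    castM h h' A⁻¹ = (castM h h' A)⁻¹ := by
  subst h; rfl

theorem castM_castM {m n m' n' m'' n'' : ℕ} (hm : m' = m) (hn : n' = n) (hm' : m'' = m')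
    (hn' : n'' = n') (A : Matrix (Fin m) (Fin n) K) :
    castM hm' hn' (castM hm hn A) = castM (hm'.trans hm) (hn'.trans hn) A := by
  subst hm hn hm' hn'; rfl

theorem castM_map {m n m' n' : ℕ} (hm : m' = m) (hn : n' = n) (A : Matrix (Fin m) (Fin n) K)
    (φ : K →+* K) : (castM hm hn A).map φ = castM hm hn (A.map φ) := rfl

theorem castM_self {m n : ℕ} (hm : m = m) (hn : n = n) (A : Matrix (Fin m) (Fin n) K) :
    castM hm hn A = A := rfl

theorem castM_family {α : Type*} {r c : α → ℕ} (x : ∀ a, Matrix (Fin (r a)) (Fin (c a)) K)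
    {a b : α} (hab : a = b) {m n : ℕ} (hr : m = r a) (hc : n = c a) (hr' : m = r b)
    (hc' : n = c b) : castM hr hc (x a) = castM hr' hc' (x b) := by
  subst hab; rfl

theorem map_inv_matrix {m : ℕ} (A : Matrix (Fin m) (Fin m) K) (φ : K →+* K) :
    A⁻¹.map φ = (A.map φ)⁻¹ := by
  have h1 : (A.map φ).det = φ A.det := (φ.map_det A).symm
  have h2 : (A.map φ).adjugate = A.adjugate.map φ := (φ.map_adjugate A).symm
  rw [Matrix.inv_def, Matrix.inv_def, h1, h2, Ring.inverse_eq_inv', ← map_inv₀]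
  ext i j
  simp

/-- Application of a field endomorphism to the entries of an invertible matrix, up to a renaming
of the indices. -/
def glMap {m m' : ℕ} (h : m' = m) (φ : K →+* K) : GL (Fin m) K →* GL (Fin m') K :=
  Units.map
    { toFun := fun A => castM h h (A.map φ)
      map_one' := by rw [Matrix.map_one φ (map_zero φ) (map_one φ), castM_one]
      map_mul' := fun A B => by rw [Matrix.map_mul, castM_mul] }

theorem coe_glMap {m m' : ℕ} (h : m' = m) (φ : K →+* K) (g : GL (Fin m) K) :
    (glMap h φ g).1 = castM h h (g.1.map φ) := rfl

end castM

section representations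

variable {K : Type*} [Field K]

/-- The representation space `E_V = ⨁_h Hom(V_{h'}, V_{h''})`, for `V` the graded vector space
with `V_i = K^{ν_i}` on which `a : V_i → V_{a(i)}` is the identity in coordinates. -/
@[ext]
structure RepSpace (K : Type*) (ν : Q.Dim) where
  mat : ∀ h : Ω, Matrix (Fin (ν (Q.orb (Q.tgt h)))) (Fin (ν (Q.orb (Q.src h)))) K

/-- The group `G_V = ∏_i GL(V_i)`. -/
abbrev Grp (K : Type*) [Field K] (ν : Q.Dim) : Type _ := ∀ i : ι, GL (Fin (ν (Q.orb i))) K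

/-- The action `(g.x)_h = g_{h''} x_h g_{h'}⁻¹`. -/
instance (ν : Q.Dim) : MulAction (Q.Grp K ν) (Q.RepSpace K ν) where
  smul g x := ⟨fun h => (g (Q.tgt h)).1 * x.mat h * ((g (Q.src h))⁻¹).1⟩
  one_smul x := RepSpace.ext <| funext fun h => by
    show (1 : GL _ K).1 * x.mat h * ((1 : GL _ K)⁻¹).1 = x.mat h
    rw [inv_one, Units.val_one, Units.val_one, Matrix.one_mul, Matrix.mul_one]
  mul_smul g g' x := RepSpace.ext <| funext fun h => by
    show (g (Q.tgt h) * g' (Q.tgt h)).1 * x.mat h * ((g (Q.src h) * g' (Q.src h))⁻¹).1 =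
      (g (Q.tgt h)).1 * ((g' (Q.tgt h)).1 * x.mat h * ((g' (Q.src h))⁻¹).1) * ((g (Q.src h))⁻¹).1
    rw [mul_inv_rev, Units.val_mul, Units.val_mul]
    simp only [Matrix.mul_assoc]

theorem smul_apply {ν : Q.Dim} (g : Q.Grp K ν) (x : Q.RepSpace K ν) (h : Ω) :
    (g • x).mat h = (g (Q.tgt h)).1 * x.mat h * ((g (Q.src h))⁻¹).1 := rfl

variable {Q}

/-- The twisted Frobenius `F = Fr ∘ a` on `E_V`: `F(x)_h` is `x_{a(h)}` with `φ` (the Frobenius map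
of `K`) applied to all entries. -/
def frob (φ : K →+* K) {ν : Q.Dim} (x : Q.RepSpace K ν) : Q.RepSpace K ν :=
  ⟨fun h => castM (by rw [Q.orb_tgt_aE]) (by rw [Q.orb_src_aE]) ((x.mat (Q.aE h)).map φ)⟩

/-- The twisted Frobenius on `G_V`. -/
def frobG (φ : K →+* K) {ν : Q.Dim} : Q.Grp K ν →* Q.Grp K ν where
  toFun g := fun i => glMap (by rw [Q.orb_aV]) φ (g (Q.aV i))
  map_one' := funext fun i => by simp
  map_mul' g g' := funext fun i => by simp

theorem frobG_apply (φ : K →+* K) {ν : Q.Dim} (g : Q.Grp K ν) (i : ι) :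
    (frobG φ g i).1 = castM (by rw [Q.orb_aV]) (by rw [Q.orb_aV]) ((g (Q.aV i)).1.map φ) := rfl

theorem frobG_inv_apply (φ : K →+* K) {ν : Q.Dim} (g : Q.Grp K ν) (i : ι) :
    ((frobG φ g i)⁻¹).1 =
      castM (by rw [Q.orb_aV]) (by rw [Q.orb_aV]) (((g (Q.aV i))⁻¹).1.map φ) := by
  have : (frobG φ g i)⁻¹ = frobG φ g⁻¹ i := by rw [map_inv]; rfl
  rw [this, frobG_apply]; rfl

theorem frob_smul (φ : K →+* K) {ν : Q.Dim} (g : Q.Grp K ν) (x : Q.RepSpace K ν) :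
    frob φ (g • x) = frobG φ g • frob φ x := by
  refine RepSpace.ext (funext fun h => ?_)
  have e1 : ν (Q.orb (Q.tgt h)) = ν (Q.orb (Q.tgt (Q.aE h))) := by rw [Q.orb_tgt_aE]
  have e2 : ν (Q.orb (Q.src h)) = ν (Q.orb (Q.src (Q.aE h))) := by rw [Q.orb_src_aE]
  rw [smul_apply, frobG_apply, frobG_inv_apply]
  simp only [frob, smul_apply, Matrix.map_mul]
  rw [castM_mul _ e2, castM_mul _ e1]
  congr 1
  · congr 1
    exact castM_family (fun i => (g i).1.map φ) (Q.tgt_aE h) _ _ _ _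
  · exact castM_family (fun i => ((g i)⁻¹).1.map φ) (Q.src_aE h) _ _ _ _

/-- `E_V^F`. -/
abbrev RepF (φ : K →+* K) (ν : Q.Dim) : Type _ :=
  ↥(Function.fixedPoints (frob φ : Q.RepSpace K ν → Q.RepSpace K ν))

/-- `G_V^F`. -/
abbrev GrpF (φ : K →+* K) (ν : Q.Dim) : Type _ :=
  ↥(Function.fixedPoints (frobG φ : Q.Grp K ν → Q.Grp K ν))

/-- The space `H_ν` of `G_V^F`-invariant functions on `E_V^F` with values in `R`. -/
def hallSpace (φ : K →+* K) (R : Type*) [Field R] (ν : Q.Dim) :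
    Submodule R (RepF φ ν → R) where
  carrier := {f | ∀ (g : GrpF φ ν) (x y : RepF φ ν), g.1 • x.1 = y.1 → f y = f x}
  add_mem' := fun hf hf' g x y h => by simp [hf g x y h, hf' g x y h]
  zero_mem' := fun _ _ _ _ => rfl
  smul_mem' := fun c f hf g x y h => by simp [hf g x y h]

end representations

/-! ### The induction diagram -/

section blocks

variable {K : Type*} [Field K]

/-- For `V = T ⊕ W` (first the coordinates of `T`, then those of `W`), the map `T → T` induced on
`V/W`. -/
def blockT (a b c d : ℕ) (A : Matrix (Fin (a + b)) (Fin (c + d)) K) : Matrix (Fin a) (Fin c) K :=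
  A.submatrix (Fin.castAdd b) (Fin.castAdd d)

/-- The map induced on `W`. -/
def blockW (a b c d : ℕ) (A : Matrix (Fin (a + b)) (Fin (c + d)) K) : Matrix (Fin b) (Fin d) K :=
  A.submatrix (Fin.natAdd a) (Fin.natAdd c)

/-- `A` maps `W` into `W`. -/
def MapsW (a b c d : ℕ) (A : Matrix (Fin (a + b)) (Fin (c + d)) K) : Prop :=
  ∀ (r : Fin a) (s : Fin d), A (Fin.castAdd b r) (Fin.natAdd c s) = 0

theorem MapsW.mul {a b c d k l : ℕ} {A : Matrix (Fin (a + b)) (Fin (c + d)) K}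
    {B : Matrix (Fin (c + d)) (Fin (k + l)) K} (hA : MapsW a b c d A) (hB : MapsW c d k l B) :
    MapsW a b k l (A * B) := fun r s => by
  rw [Matrix.mul_apply, Fin.sum_univ_add]
  simp [hA r, hB _ s]

theorem blockT_mul {a b c d k l : ℕ} {A : Matrix (Fin (a + b)) (Fin (c + d)) K}
    {B : Matrix (Fin (c + d)) (Fin (k + l)) K} (hA : MapsW a b c d A) :
    blockT a b k l (A * B) = blockT a b c d A * blockT c d k l B := by
  ext r s
  simp [blockT, Matrix.mul_apply, Fin.sum_univ_add, hA r]

theorem blockW_mul {a b c d k l : ℕ} {A : Matrix (Fin (a + b)) (Fin (c + d)) K}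
    {B : Matrix (Fin (c + d)) (Fin (k + l)) K} (hB : MapsW c d k l B) :
    blockW a b k l (A * B) = blockW a b c d A * blockW c d k l B := by
  ext r s
  simp [blockW, Matrix.mul_apply, Fin.sum_univ_add, hB _ s]

theorem mapsW_one (a b : ℕ) : MapsW a b a b (1 : Matrix (Fin (a + b)) (Fin (a + b)) K) :=
  fun r s => Matrix.one_apply_ne (by
    intro h
    have := congrArg Fin.val h
    simp at this
    omega)

theorem blockT_one (a b : ℕ) : blockT a b a b (1 : Matrix (Fin (a + b)) (Fin (a + b)) K) = 1 :=
  Matrix.submatrix_one _ (Fin.castAdd_injective a b)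

theorem blockW_one (a b : ℕ) : blockW a b a b (1 : Matrix (Fin (a + b)) (Fin (a + b)) K) = 1 :=
  Matrix.submatrix_one _ (Fin.natAdd_injective b a)

theorem MapsW.castM {a b c d a' b' c' d' : ℕ} (ha : a' = a) (hb : b' = b) (hc : c' = c)
    (hd : d' = d) (h₁ : a' + b' = a + b) (h₂ : c' + d' = c + d)
    {A : Matrix (Fin (a + b)) (Fin (c + d)) K} (hA : MapsW a b c d A) (φ : K →+* K) :
    MapsW a' b' c' d' (castM h₁ h₂ (A.map φ)) := by
  subst ha hb hc hd
  intro r s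
  exact (congrArg φ (hA r s)).trans (map_zero φ)

theorem blockT_castM {a b c d a' b' c' d' : ℕ} (ha : a' = a) (hb : b' = b) (hc : c' = c)
    (hd : d' = d) (h₁ : a' + b' = a + b) (h₂ : c' + d' = c + d)
    (A : Matrix (Fin (a + b)) (Fin (c + d)) K) (φ : K →+* K) :
    blockT a' b' c' d' (AdmissibleQuiver.castM h₁ h₂ (A.map φ)) =
      AdmissibleQuiver.castM ha hc ((blockT a b c d A).map φ) := by
  subst ha hb hc hd; rfl

theorem blockW_castM {a b c d a' b' c' d' : ℕ} (ha : a' = a) (hb : b' = b) (hc : c' = c)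
    (hd : d' = d) (h₁ : a' + b' = a + b) (h₂ : c' + d' = c + d)
    (A : Matrix (Fin (a + b)) (Fin (c + d)) K) (φ : K →+* K) :
    blockW a' b' c' d' (AdmissibleQuiver.castM h₁ h₂ (A.map φ)) =
      AdmissibleQuiver.castM hb hd ((blockW a b c d A).map φ) := by
  subst ha hb hc hd; rfl

end blocks

section induction

variable {Q}
variable {K : Type*} [Field K] {τ ω : Q.Dim}

/-- The space `S_W` of all `x ∈ E_V` that leave `W` invariant, where `V = T ⊕ W`. -/
abbrev StabSpace (K : Type*) [Field K] (τ ω : Q.Dim) : Type _ :=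
  {x : Q.RepSpace K (τ + ω) // ∀ h, MapsW (τ (Q.orb (Q.tgt h))) (ω (Q.orb (Q.tgt h)))
    (τ (Q.orb (Q.src h))) (ω (Q.orb (Q.src h))) (x.mat h)}

/-- `x ↦ x^T`. -/
def partT (x : Q.RepSpace K (τ + ω)) : Q.RepSpace K τ :=
  ⟨fun h => blockT (τ (Q.orb (Q.tgt h))) (ω (Q.orb (Q.tgt h))) (τ (Q.orb (Q.src h)))
    (ω (Q.orb (Q.src h))) (x.mat h)⟩

/-- `x ↦ x^W`. -/
def partW (x : Q.RepSpace K (τ + ω)) : Q.RepSpace K ω :=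
  ⟨fun h => blockW (τ (Q.orb (Q.tgt h))) (ω (Q.orb (Q.tgt h))) (τ (Q.orb (Q.src h)))
    (ω (Q.orb (Q.src h))) (x.mat h)⟩

theorem partT_frob (φ : K →+* K) (x : Q.RepSpace K (τ + ω)) :
    partT (frob φ x) = frob φ (partT x) := RepSpace.ext <| funext fun h =>
  blockT_castM (by rw [Q.orb_tgt_aE]) (by rw [Q.orb_tgt_aE]) (by rw [Q.orb_src_aE])
    (by rw [Q.orb_src_aE]) _ _ (x.mat (Q.aE h)) φ

theorem partW_frob (φ : K →+* K) (x : Q.RepSpace K (τ + ω)) :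
    partW (frob φ x) = frob φ (partW x) := RepSpace.ext <| funext fun h =>
  blockW_castM (by rw [Q.orb_tgt_aE]) (by rw [Q.orb_tgt_aE]) (by rw [Q.orb_src_aE])
    (by rw [Q.orb_src_aE]) _ _ (x.mat (Q.aE h)) φ

/-- The twisted Frobenius on `S_W`. -/
def frobS (φ : K →+* K) (x : StabSpace K τ ω) : StabSpace K τ ω :=
  ⟨frob φ x.1, fun h => (x.2 (Q.aE h)).castM (by rw [Q.orb_tgt_aE]) (by rw [Q.orb_tgt_aE])
    (by rw [Q.orb_src_aE]) (by rw [Q.orb_src_aE]) _ _ φ⟩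

/-- The stabilizer of `W` in `G_V`: `g` and `g⁻¹` map `W` into `W`. -/
def parabolic (K : Type*) [Field K] (τ ω : Q.Dim) : Subgroup (Q.Grp K (τ + ω)) where
  carrier := {g | ∀ i, MapsW (τ (Q.orb i)) (ω (Q.orb i)) (τ (Q.orb i)) (ω (Q.orb i)) (g i).1 ∧
    MapsW (τ (Q.orb i)) (ω (Q.orb i)) (τ (Q.orb i)) (ω (Q.orb i)) ((g i)⁻¹).1}
  one_mem' := fun i => ⟨mapsW_one _ _, by
    rw [Pi.one_apply, inv_one]; exact mapsW_one _ _⟩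
  mul_mem' := fun {g g'} hg hg' i => ⟨(hg i).1.mul (hg' i).1, by
    rw [Pi.mul_apply, mul_inv_rev]; exact (hg' i).2.mul (hg i).2⟩
  inv_mem' := fun {g} hg i => ⟨(hg i).2, by
    rw [Pi.inv_apply, inv_inv]; exact (hg i).1⟩

/-- The unipotent radical of the stabilizer of `W`: the kernel of its map to `G_T × G_W`. -/
def unipotent (K : Type*) [Field K] (τ ω : Q.Dim) : Subgroup (Q.Grp K (τ + ω)) where
  carrier := {g | g ∈ parabolic K τ ω ∧ ∀ i,
    blockT (τ (Q.orb i)) (ω (Q.orb i)) (τ (Q.orb i)) (ω (Q.orb i)) (g i).1 = 1 ∧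
    blockW (τ (Q.orb i)) (ω (Q.orb i)) (τ (Q.orb i)) (ω (Q.orb i)) (g i).1 = 1}
  one_mem' := ⟨one_mem _, fun i => ⟨blockT_one _ _, blockW_one _ _⟩⟩
  mul_mem' := fun {g g'} hg hg' => ⟨mul_mem hg.1 hg'.1, fun i =>
    ⟨(blockT_mul (hg.1 i).1).trans (by rw [(hg.2 i).1, (hg'.2 i).1, one_mul]),
      (blockW_mul (hg'.1 i).1).trans (by rw [(hg.2 i).2, (hg'.2 i).2, one_mul])⟩⟩
  inv_mem' := fun {g} hg => ⟨inv_mem hg.1, fun i => by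
    have h1 : (g i).1 * ((g i)⁻¹).1 = 1 := Units.mul_inv (g i)
    constructor
    · have h2 := blockT_mul (K := K) (B := ((g i)⁻¹).1) (hg.1 i).1
      rw [(hg.2 i).1, one_mul] at h2
      exact h2.symm.trans ((congrArg _ h1).trans (blockT_one _ _))
    · have h2 := blockW_mul (K := K) (A := (g i).1) (hg.1 i).2
      rw [(hg.2 i).2, one_mul] at h2
      exact h2.symm.trans ((congrArg _ h1).trans (blockW_one _ _))⟩

theorem frobG_mem_parabolic (φ : K →+* K) {g : Q.Grp K (τ + ω)} (hg : g ∈ parabolic K τ ω) :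
    frobG φ g ∈ parabolic K τ ω := fun i => by
  refine ⟨(hg (Q.aV i)).1.castM (by rw [Q.orb_aV]) (by rw [Q.orb_aV]) (by rw [Q.orb_aV])
    (by rw [Q.orb_aV]) _ _ φ, ?_⟩
  rw [frobG_inv_apply]
  exact (hg (Q.aV i)).2.castM (by rw [Q.orb_aV]) (by rw [Q.orb_aV]) (by rw [Q.orb_aV])
    (by rw [Q.orb_aV]) _ _ φ

theorem frobG_mem_unipotent (φ : K →+* K) {g : Q.Grp K (τ + ω)} (hg : g ∈ unipotent K τ ω) :
    frobG φ g ∈ unipotent K τ ω := by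
  refine ⟨frobG_mem_parabolic φ hg.1, fun i => ⟨?_, ?_⟩⟩
  · refine (blockT_castM (by rw [Q.orb_aV]) (by rw [Q.orb_aV]) (by rw [Q.orb_aV])
      (by rw [Q.orb_aV]) _ _ (g (Q.aV i)).1 φ).trans ?_
    rw [(hg.2 (Q.aV i)).1, Matrix.map_one φ (map_zero φ) (map_one φ), castM_one]
  · refine (blockW_castM (by rw [Q.orb_aV]) (by rw [Q.orb_aV]) (by rw [Q.orb_aV])
      (by rw [Q.orb_aV]) _ _ (g (Q.aV i)).1 φ).trans ?_
    rw [(hg.2 (Q.aV i)).2, Matrix.map_one φ (map_zero φ) (map_one φ), castM_one]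

theorem partT_smul {u : Q.Grp K (τ + ω)} (hu : u ∈ unipotent K τ ω) {x : Q.RepSpace K (τ + ω)}
    (hx : ∀ h, MapsW (τ (Q.orb (Q.tgt h))) (ω (Q.orb (Q.tgt h)))
      (τ (Q.orb (Q.src h))) (ω (Q.orb (Q.src h))) (x.mat h)) :
    partT (u • x) = partT x := RepSpace.ext <| funext fun h => by
  refine (blockT_mul ((hu.1 (Q.tgt h)).1.mul (hx h))).trans ?_
  rw [blockT_mul (hu.1 (Q.tgt h)).1, (hu.2 (Q.tgt h)).1, Matrix.one_mul]
  refine (congrArg _ ((inv_mem hu).2 (Q.src h)).1).trans ?_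
  rw [Matrix.mul_one]; rfl

theorem partW_smul {u : Q.Grp K (τ + ω)} (hu : u ∈ unipotent K τ ω) {x : Q.RepSpace K (τ + ω)}
    (hx : ∀ h, MapsW (τ (Q.orb (Q.tgt h))) (ω (Q.orb (Q.tgt h)))
      (τ (Q.orb (Q.src h))) (ω (Q.orb (Q.src h))) (x.mat h)) :
    partW (u • x) = partW x := RepSpace.ext <| funext fun h => by
  refine (blockW_mul (hu.1 (Q.src h)).2).trans ?_
  rw [blockW_mul (hx h), (hu.2 (Q.tgt h)).2, Matrix.one_mul]
  refine (congrArg _ ((inv_mem hu).2 (Q.src h)).2).trans ?_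
  rw [Matrix.mul_one]; rfl

/-- The orbit relation on `G_V × S_W` of a subgroup `B`, for the action
`b.(g, x) = (g b⁻¹, b.x)`. -/
def orbitSetoid (B : Subgroup (Q.Grp K (τ + ω))) :
    Setoid (Q.Grp K (τ + ω) × StabSpace K τ ω) where
  r z z' := ∃ b ∈ B, z'.1 = z.1 * b⁻¹ ∧ z'.2.1 = b • z.2.1
  iseqv :=
    { refl := fun z => ⟨1, one_mem _, by simp, (one_smul _ _).symm⟩
      symm := fun {z z'} ⟨b, hb, h1, h2⟩ => ⟨b⁻¹, inv_mem hb, by simp [h1], by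
        rw [h2, inv_smul_smul]⟩
      trans := fun {z z' z''} ⟨b, hb, h1, h2⟩ ⟨c, hc, h3, h4⟩ => ⟨c * b, mul_mem hc hb, by
        rw [h3, h1, mul_inv_rev, mul_assoc], by rw [h4, h2, mul_smul]⟩ }

/-- `E'`, the set of orbits of the unipotent radical `U` on `G_V × S_W`. -/
abbrev EPrime (K : Type*) [Field K] (τ ω : Q.Dim) : Type _ :=
  Quotient (orbitSetoid (unipotent K τ ω))

/-- `E''`, the set of orbits of the stabilizer of `W` on `G_V × S_W`. -/
abbrev EDoublePrime (K : Type*) [Field K] (τ ω : Q.Dim) : Type _ :=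
  Quotient (orbitSetoid (parabolic K τ ω))

/-- The twisted Frobenius on `E'`. -/
def frobE' (φ : K →+* K) : EPrime K τ ω → EPrime K τ ω :=
  Quotient.map (fun z => (frobG φ z.1, frobS φ z.2)) fun _ _ ⟨b, hb, h1, h2⟩ =>
    ⟨frobG φ b, frobG_mem_unipotent φ hb, by simp [h1], by simp [frobS, h2, frob_smul]⟩

/-- The twisted Frobenius on `E''`. -/
def frobE'' (φ : K →+* K) : EDoublePrime K τ ω → EDoublePrime K τ ω :=
  Quotient.map (fun z => (frobG φ z.1, frobS φ z.2)) fun _ _ ⟨b, hb, h1, h2⟩ =>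
    ⟨frobG φ b, frobG_mem_parabolic φ hb, by simp [h1], by simp [frobS, h2, frob_smul]⟩

/-- The first component of `p₁ : E' → E_T × E_W`, `[g, x] ↦ x^T`. -/
def p₁T : EPrime K τ ω → Q.RepSpace K τ :=
  Quotient.lift (fun z => partT z.2.1) fun z _ ⟨_, hb, _, h2⟩ => by
    simp only [h2]; exact (partT_smul hb z.2.2).symm

/-- The second component of `p₁ : E' → E_T × E_W`, `[g, x] ↦ x^W`. -/
def p₁W : EPrime K τ ω → Q.RepSpace K ω :=
  Quotient.lift (fun z => partW z.2.1) fun z _ ⟨_, hb, _, h2⟩ => by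
    simp only [h2]; exact (partW_smul hb z.2.2).symm

/-- `p₂ : E' → E''`, `[g, x] ↦ [g, x]`. -/
def p₂ : EPrime K τ ω → EDoublePrime K τ ω :=
  Quotient.map id fun _ _ ⟨b, hb, h⟩ => ⟨b, hb.1, h⟩

/-- `p₃ : E'' → E_V`, `[g, x] ↦ g.x`. -/
def p₃ : EDoublePrime K τ ω → Q.RepSpace K (τ + ω) :=
  Quotient.lift (fun z => z.1 • z.2.1) fun z _ ⟨b, _, h1, h2⟩ => by
    simp only [h1, h2, mul_smul, inv_smul_smul]

/-- The map induced on fixed points by a map compatible with the twisted Frobenius maps. -/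
def fixMap {X Y : Type*} {F : X → X} {F' : Y → Y} (f : X → Y) (hf : Function.Semiconj f F F') :
    Function.fixedPoints F → Function.fixedPoints F' :=
  fun x => ⟨f x.1, by
    show F' (f x.1) = f x.1
    rw [← hf x.1, show F x.1 = x.1 from x.2]⟩

theorem p₁T_semiconj (φ : K →+* K) :
    Function.Semiconj (p₁T (K := K) (τ := τ) (ω := ω)) (frobE' φ) (frob φ) := by
  rintro ⟨z⟩
  exact partT_frob φ z.2.1

theorem p₁W_semiconj (φ : K →+* K) :
    Function.Semiconj (p₁W (K := K) (τ := τ) (ω := ω)) (frobE' φ) (frob φ) := by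
  rintro ⟨z⟩
  exact partW_frob φ z.2.1

theorem p₂_semiconj (φ : K →+* K) :
    Function.Semiconj (p₂ (K := K) (τ := τ) (ω := ω)) (frobE' φ) (frobE'' φ) := by
  rintro ⟨z⟩
  rfl

theorem p₃_semiconj (φ : K →+* K) :
    Function.Semiconj (p₃ (K := K) (τ := τ) (ω := ω)) (frobE'' φ) (frob φ) := by
  rintro ⟨z⟩
  exact (frob_smul φ z.1 z.2.1).symm

/-- Push-forward of functions, `f_!(u)(y) = ∑_{f(x) = y} u(x)`. -/
def pushforward {X Y M : Type*} [AddCommMonoid M] (f : X → Y) (u : X → M) (y : Y) : M :=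
  ∑ᶠ x : {x : X // f x = y}, u x.1

theorem pushforward_equiv {X Y M : Type*} [AddCommMonoid M] (f : X → Y) (u : X → M)
    (σ : X ≃ X) (ρ : Y ≃ Y) (hf : ∀ x, f (σ x) = ρ (f x)) (hu : ∀ x, u (σ x) = u x) (y : Y) :
    pushforward f u (ρ y) = pushforward f u y := by
  rw [pushforward, pushforward, ← finsum_comp_equiv (σ.subtypeEquiv (p := fun x => f x = y)
    (q := fun x => f x = ρ y) (fun x => by rw [hf, ρ.apply_eq_iff_eq]))]
  exact finsum_congr fun x => hu x.1

/-- Left translation by `g` on the orbit sets. -/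
def translate (B : Subgroup (Q.Grp K (τ + ω))) (g : Q.Grp K (τ + ω)) :
    Quotient (orbitSetoid (ω := ω) B) ≃ Quotient (orbitSetoid (ω := ω) B) where
  toFun := Quotient.map (fun z => (g * z.1, z.2)) fun _ _ ⟨b, hb, h1, h2⟩ =>
    ⟨b, hb, by simp [h1, mul_assoc], h2⟩
  invFun := Quotient.map (fun z => (g⁻¹ * z.1, z.2)) fun _ _ ⟨b, hb, h1, h2⟩ =>
    ⟨b, hb, by simp [h1, mul_assoc], h2⟩
  left_inv := by
    rintro ⟨z⟩
    exact congrArg (Quotient.mk _) (Prod.ext (inv_mul_cancel_left g z.1) rfl)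
  right_inv := by
    rintro ⟨z⟩
    exact congrArg (Quotient.mk _) (Prod.ext (mul_inv_cancel_left g z.1) rfl)

/-- The unnormalized product `(p₃)_! (p₂)_! (p₁)^* (f₁ ⊗ f₂)`, a function on `E_V^F`. -/
def rawInd (φ : K →+* K) {R : Type*} [Field R] (f₁ : RepF (K := K) φ τ → R)
    (f₂ : RepF (K := K) φ ω → R) : RepF (K := K) φ (τ + ω) → R :=
  pushforward (fixMap p₃ (p₃_semiconj φ)) (pushforward (fixMap p₂ (p₂_semiconj φ))
    fun z => f₁ (fixMap p₁T (p₁T_semiconj φ) z) * f₂ (fixMap p₁W (p₁W_semiconj φ) z))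

/-- A bijection that commutes with `F` permutes the fixed points of `F`. -/
def fixEquiv {X : Type*} {F : X → X} (σ : X ≃ X) (hσ : Function.Semiconj σ F F) :
    Function.fixedPoints F ≃ Function.fixedPoints F :=
  σ.subtypeEquiv fun x => by
    show F x = x ↔ F (σ x) = σ x
    rw [← hσ x, σ.apply_eq_iff_eq]

theorem rawInd_mem (φ : K →+* K) {R : Type*} [Field R] (f₁ : RepF (K := K) φ τ → R)
    (f₂ : RepF (K := K) φ ω → R) : rawInd φ f₁ f₂ ∈ hallSpace φ R (τ + ω) := by
  rintro ⟨g, hg⟩ x y hxy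
  have hg' : frobG φ g = g := hg
  have h1 : Function.Semiconj (translate (unipotent K τ ω) g) (frobE' φ) (frobE' φ) := by
    rintro ⟨z⟩
    refine congrArg (Quotient.mk _) (Prod.ext ?_ rfl)
    show g * frobG φ z.1 = frobG φ (g * z.1)
    rw [map_mul, hg']
  have h2 : Function.Semiconj (translate (parabolic K τ ω) g) (frobE'' φ) (frobE'' φ) := by
    rintro ⟨z⟩
    refine congrArg (Quotient.mk _) (Prod.ext ?_ rfl)
    show g * frobG φ z.1 = frobG φ (g * z.1)
    rw [map_mul, hg']
  have h3 : Function.Semiconj (MulAction.toPerm g : Equiv.Perm (Q.RepSpace K (τ + ω)))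
      (frob φ) (frob φ) := fun x => by
    show g • frob φ x = frob φ (g • x)
    rw [frob_smul, hg']
  have hy : y = fixEquiv _ h3 x := Subtype.ext hxy.symm
  rw [hy]
  refine pushforward_equiv _ _ (fixEquiv _ h2) (fixEquiv _ h3) ?_ (fun w => ?_) x
  · rintro ⟨⟨z⟩, hz⟩
    exact Subtype.ext (mul_smul g z.1 z.2.1)
  · refine pushforward_equiv _ _ (fixEquiv _ h1) (fixEquiv _ h2) ?_ ?_ w
    · rintro ⟨⟨z⟩, hz⟩
      rfl
    · rintro ⟨⟨z⟩, hz⟩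
      rfl

/-- `m_Ω(τ, ω) = ∑_i τ_i ω_i + ∑_h τ_{h'} ω_{h''}`. -/
def mExp (τ ω : Q.Dim) : ℕ :=
  ∑ᶠ i : ι, τ (Q.orb i) * ω (Q.orb i) + ∑ᶠ h : Ω, τ (Q.orb (Q.src h)) * ω (Q.orb (Q.tgt h))

/-- `Ind(f₁ ⊗ f₂) = s^{-m_Ω(τ, ω)} (# G_T^F × G_W^F)⁻¹ (p₃)_! (p₂)_! (p₁)^* (f₁ ⊗ f₂)`, where `s`
stands for `q^{1/2}`. -/
def ind (φ : K →+* K) {R : Type*} [Field R] (s : R) (f₁ : hallSpace (Q := Q) φ R τ)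
    (f₂ : hallSpace (Q := Q) φ R ω) : hallSpace (Q := Q) φ R (τ + ω) :=
  ((s ^ mExp τ ω)⁻¹ * (Nat.card (GrpF (Q := Q) φ τ × GrpF (Q := Q) φ ω) : R)⁻¹) •
    ⟨rawInd φ f₁.1 f₂.1, rawInd_mem φ f₁.1 f₂.1⟩

end induction

/-! ### The Hall algebra -/

section hall

variable {K : Type*} [Field K] (φ : K →+* K) {R : Type*} [Field R] (s : R)

/-- The underlying space `⨁_{ν ∈ ℕ[I]} H_ν` of the Hall algebra; `s` stands for `q^{1/2}` and enters
the multiplication. -/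
@[nolint unusedArguments]
def HallAlgebra (_ : R) : Type _ := ⨁ ν : Q.Dim, hallSpace (Q := Q) φ R ν

instance : AddCommGroup (Q.HallAlgebra φ s) :=
  inferInstanceAs (AddCommGroup (⨁ ν : Q.Dim, hallSpace (Q := Q) φ R ν))

instance : Module R (Q.HallAlgebra φ s) :=
  inferInstanceAs (Module R (⨁ ν : Q.Dim, hallSpace (Q := Q) φ R ν))

open Classical in
/-- The inclusion of `H_ν`. -/
def hallOf (ν : Q.Dim) : hallSpace (Q := Q) φ R ν →ₗ[R] Q.HallAlgebra φ s :=
  DirectSum.lof R Q.Dim (fun ν => hallSpace (Q := Q) φ R ν) ν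

/-- The component in `H_ν`. -/
def hallComponent (ν : Q.Dim) : Q.HallAlgebra φ s →ₗ[R] hallSpace (Q := Q) φ R ν :=
  DirectSum.component R Q.Dim (fun ν => hallSpace (Q := Q) φ R ν) ν

open Classical in
/-- The dimension vectors at which an element of the Hall algebra has a non-zero component. -/
def hallSupport (f : Q.HallAlgebra φ s) : Finset Q.Dim :=
  DFinsupp.support (β := fun ν => hallSpace (Q := Q) φ R ν) f

/-- The multiplication of the Hall algebra: `f₁ ∘ f₂ = Ind(f₁ ⊗ f₂)` for homogeneous elements. -/
instance : Mul (Q.HallAlgebra φ s) where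
  mul f g := ∑ τ ∈ Q.hallSupport φ s f, ∑ ω ∈ Q.hallSupport φ s g,
    Q.hallOf φ s (τ + ω) (ind φ s (Q.hallComponent φ s τ f) (Q.hallComponent φ s ω g))

/-- The unit: the function `1` on the point `E_V^F` for `V = 0`. -/
instance : One (Q.HallAlgebra φ s) where
  one := Q.hallOf φ s 0 ⟨fun _ => 1, fun _ _ _ _ => rfl⟩

end hall

/-! ### The contraction map and the maps of Hall algebras -/

section embedding

variable {Q}
variable [Finite ι] [Finite Ω] {e : Ω} (hC : Q.IsContractible e)
variable {K : Type*} [Field K] (φ : K →+* K) {R : Type*} [Field R] (s : R)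

theorem fold_eq (i : Q.CVertex e) : fold hC i.1 = i := Subtype.ext (fold_of_notMem hC i.2)

theorem extDim_orb (ν : (contract hC).Dim) (i : ι) :
    extDim hC ν (Q.orb i) = ν ((contract hC).orb (fold hC i)) := rfl

theorem extDim_leg (ν : (contract hC).Dim) {i : ι} (hi : i ∈ Q.orbit (Q.tgt e)) :
    extDim hC ν (Q.orb i) = extDim hC ν (Q.orb (Q.src (Q.leg e hi))) := by
  rw [extDim_orb, extDim_orb]
  congr 2
  apply Subtype.ext
  rw [fold_of_mem hC hi,
    fold_of_notMem hC (hC.disjoint (src_mem (Q.leg_sameCycle e hi)))]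

theorem extDim_tgt_leg (ν : (contract hC).Dim) {i : ι} (hi : i ∈ Q.orbit (Q.tgt e)) :
    extDim hC ν (Q.orb i) = extDim hC ν (Q.orb (Q.tgt (Q.leg e hi))) := by
  rw [Q.tgt_leg]

/-- For `i ∈ [i₋]`, the map `x_{h_k} : V_{h_k'} → V_i` with `h_k'' = i`, as a square matrix. -/
def legMat {ν : (contract hC).Dim} (x : Q.RepSpace K (extDim hC ν)) {i : ι}
    (hi : i ∈ Q.orbit (Q.tgt e)) :
    Matrix (Fin (extDim hC ν (Q.orb i))) (Fin (extDim hC ν (Q.orb i))) K :=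
  castM (extDim_tgt_leg hC ν hi) (extDim_leg hC ν hi) (x.mat (Q.leg e hi))

/-- The locus `E_V^♡` where all contracted edges `h_k` act by isomorphisms. -/
def heart (e : Ω) (ν : Q.Dim) : Set (Q.RepSpace K ν) :=
  {x | ∀ h, Q.aE.SameCycle e h → Function.Bijective (x.mat h).mulVec}

open Classical in
/-- The components of the contraction map, indexed by the edges `l` of the original graph:
`x_l x_{h_k}` if `l' = h_k''`, `x_{h_k}⁻¹ x_l` if `l'' = h_k''`, and `x_l` otherwise. -/
def contractMat {ν : (contract hC).Dim} (x : Q.RepSpace K (extDim hC ν)) (l : Ω) :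
    Matrix (Fin (extDim hC ν (Q.orb (Q.tgt l)))) (Fin (extDim hC ν (Q.orb (Q.src l)))) K :=
  if h₁ : Q.src l ∈ Q.orbit (Q.tgt e) then x.mat l * legMat hC x h₁
  else if h₂ : Q.tgt l ∈ Q.orbit (Q.tgt e) then (legMat hC x h₂)⁻¹ * x.mat l
  else x.mat l

theorem extDim_tgt (ν : (contract hC).Dim) (l : Q.CEdge e) :
    ν ((contract hC).orb ((contract hC).tgt l)) = extDim hC ν (Q.orb (Q.tgt l.1)) := rfl

theorem extDim_src (ν : (contract hC).Dim) (l : Q.CEdge e) :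
    ν ((contract hC).orb ((contract hC).src l)) = extDim hC ν (Q.orb (Q.src l.1)) := rfl

/-- The contraction map `μ_ν`, `x ↦ x̂` (it is used on `E_V^♡` only). -/
def contractMap {ν : (contract hC).Dim} (x : Q.RepSpace K (extDim hC ν)) :
    (contract hC).RepSpace K ν :=
  ⟨fun l => castM (extDim_tgt hC ν l) (extDim_src hC ν l) (contractMat hC x l.1)⟩

theorem legMat_frob {ν : (contract hC).Dim} (x : Q.RepSpace K (extDim hC ν)) {i j : ι}
    (hij : Q.aV i = j) (hi : i ∈ Q.orbit (Q.tgt e)) (hj : j ∈ Q.orbit (Q.tgt e))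
    (hd : extDim hC ν (Q.orb i) = extDim hC ν (Q.orb j)) :
    legMat hC (frob φ x) hi = castM hd hd ((legMat hC x hj).map φ) := by
  subst hij
  rw [legMat, legMat, frob, castM_castM, castM_map, castM_castM]
  exact castM_family (fun h => (x.mat h).map φ) (hC.leg_aV hi hj).symm _ _ _ _

theorem contractMat_frob {ν : (contract hC).Dim} (x : Q.RepSpace K (extDim hC ν)) (l : Ω)
    (h₁ : extDim hC ν (Q.orb (Q.tgt l)) = extDim hC ν (Q.orb (Q.tgt (Q.aE l))))
    (h₂ : extDim hC ν (Q.orb (Q.src l)) = extDim hC ν (Q.orb (Q.src (Q.aE l)))) :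
    contractMat hC (frob φ x) l = castM h₁ h₂ ((contractMat hC x (Q.aE l)).map φ) := by
  have hs : Q.src (Q.aE l) ∈ Q.orbit (Q.tgt e) ↔ Q.src l ∈ Q.orbit (Q.tgt e) := by
    rw [Q.src_aE, aV_mem_orbit]
  have ht : Q.tgt (Q.aE l) ∈ Q.orbit (Q.tgt e) ↔ Q.tgt l ∈ Q.orbit (Q.tgt e) := by
    rw [Q.tgt_aE, aV_mem_orbit]
  by_cases c₁ : Q.src l ∈ Q.orbit (Q.tgt e)
  · rw [contractMat, contractMat, dif_pos c₁, dif_pos (hs.2 c₁), Matrix.map_mul,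
      castM_mul _ h₂, legMat_frob hC φ x (Q.src_aE l).symm c₁ (hs.2 c₁) h₂]
    rfl
  · by_cases c₂ : Q.tgt l ∈ Q.orbit (Q.tgt e)
    · rw [contractMat, contractMat, dif_neg c₁, dif_neg (fun h => c₁ (hs.1 h)), dif_pos c₂,
        dif_pos (ht.2 c₂), Matrix.map_mul, castM_mul _ h₁, map_inv_matrix, castM_inv,
        legMat_frob hC φ x (Q.tgt_aE l).symm c₂ (ht.2 c₂) h₁]
      rfl
    · rw [contractMat, contractMat, dif_neg c₁, dif_neg (fun h => c₁ (hs.1 h)), dif_neg c₂,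
        dif_neg (fun h => c₂ (ht.1 h))]
      rfl

theorem contractMap_frob {ν : (contract hC).Dim} (x : Q.RepSpace K (extDim hC ν)) :
    contractMap hC (frob φ x) = frob φ (contractMap hC x) := by
  refine RepSpace.ext (funext fun l => ?_)
  simp only [contractMap, frob]
  rw [castM_map, castM_castM]
  exact (congrArg _ (contractMat_frob hC φ x l.1 (by rw [Q.orb_tgt_aE])
    (by rw [Q.orb_src_aE]))).trans (castM_castM _ _ _ _ _)

theorem extDim_val (ν : (contract hC).Dim) (i : Q.CVertex e) :
    ν ((contract hC).orb i) = extDim hC ν (Q.orb i.1) := by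
  rw [extDim_orb, fold_eq]

/-- The projection `G_V → G_V̂` that forgets the components at `[i₋]`. -/
def projG {ν : (contract hC).Dim} (g : Q.Grp K (extDim hC ν)) : (contract hC).Grp K ν :=
  fun i => glMap (extDim_val hC ν i) (RingHom.id K) (g i.1)

theorem projG_apply {ν : (contract hC).Dim} (g : Q.Grp K (extDim hC ν)) (i : Q.CVertex e) :
    (projG hC g i).1 = castM (extDim_val hC ν i) (extDim_val hC ν i) (g i.1).1 := rfl

theorem projG_inv_apply {ν : (contract hC).Dim} (g : Q.Grp K (extDim hC ν)) (i : Q.CVertex e) :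
    ((projG hC g i)⁻¹).1 =
      castM (extDim_val hC ν i) (extDim_val hC ν i) ((g i.1)⁻¹).1 := by
  rw [projG, ← map_inv]; rfl

theorem projG_frob {ν : (contract hC).Dim} (g : Q.Grp K (extDim hC ν)) :
    projG hC (frobG φ g) = frobG φ (projG hC g) := by
  funext i
  refine Units.ext ?_
  rw [projG_apply, frobG_apply, frobG_apply, projG_apply, castM_map, castM_castM, castM_castM]
  rfl

theorem extDim_fold (ν : (contract hC).Dim) (i : ι) :
    extDim hC ν (Q.orb i) = extDim hC ν (Q.orb (fold hC i).1) := by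
  rw [extDim_orb, extDim_orb, fold_eq]

theorem legMat_smul {ν : (contract hC).Dim} (g : Q.Grp K (extDim hC ν))
    (x : Q.RepSpace K (extDim hC ν)) {i : ι} (hi : i ∈ Q.orbit (Q.tgt e)) :
    legMat hC (g • x) hi = (g i).1 * legMat hC x hi *
      castM (extDim_fold hC ν i) (extDim_fold hC ν i) ((g (fold hC i).1)⁻¹).1 := by
  rw [legMat, smul_apply, castM_mul _ (extDim_leg hC ν hi), castM_mul _ (extDim_tgt_leg hC ν hi)]
  congr 1
  · congr 1
    exact castM_family (fun i => (g i).1) (Q.tgt_leg e hi) _ _ rfl rfl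
  · exact castM_family (fun i => ((g i)⁻¹).1) (fold_of_mem hC hi).symm _ _ _ _

theorem contractMat_smul {ν : (contract hC).Dim} (g : Q.Grp K (extDim hC ν))
    (x : Q.RepSpace K (extDim hC ν)) {l : Ω}
    (hl : ¬ (Q.src l ∈ Q.orbit (Q.tgt e) ∧ Q.tgt l ∈ Q.orbit (Q.tgt e))) :
    contractMat hC (g • x) l =
      castM (extDim_fold hC ν _) (extDim_fold hC ν _) (g (fold hC (Q.tgt l)).1).1 *
        contractMat hC x l *
        castM (extDim_fold hC ν _) (extDim_fold hC ν _) ((g (fold hC (Q.src l)).1)⁻¹).1 := by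
  have key : ∀ i, i ∉ Q.orbit (Q.tgt e) →
      castM (extDim_fold hC ν i) (extDim_fold hC ν i) (g (fold hC i).1).1 = (g i).1 :=
    fun i hi => castM_family (fun i => (g i).1) (fold_of_notMem hC hi) _ _ rfl rfl
  have key' : ∀ i, i ∉ Q.orbit (Q.tgt e) →
      castM (extDim_fold hC ν i) (extDim_fold hC ν i) ((g (fold hC i).1)⁻¹).1 = ((g i)⁻¹).1 :=
    fun i hi => castM_family (fun i => ((g i)⁻¹).1) (fold_of_notMem hC hi) _ _ rfl rfl
  by_cases c₁ : Q.src l ∈ Q.orbit (Q.tgt e)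
  · have c₂ : Q.tgt l ∉ Q.orbit (Q.tgt e) := fun h => hl ⟨c₁, h⟩
    rw [contractMat, contractMat, dif_pos c₁, dif_pos c₁, key _ c₂, legMat_smul, smul_apply]
    have h0 : ((g (Q.src l))⁻¹).1 * (g (Q.src l)).1 = 1 := Units.inv_mul _
    simp only [Matrix.mul_assoc]
    rw [← Matrix.mul_assoc _ (g (Q.src l)).1, h0, Matrix.one_mul]
  · by_cases c₂ : Q.tgt l ∈ Q.orbit (Q.tgt e)
    · rw [contractMat, contractMat, dif_neg c₁, dif_neg c₁, dif_pos c₂, dif_pos c₂, key' _ c₁,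
        legMat_smul, smul_apply, Matrix.mul_inv_rev, Matrix.mul_inv_rev, ← castM_inv,
        ← Matrix.coe_units_inv, ← Matrix.coe_units_inv, inv_inv]
      have h0 : ((g (Q.tgt l))⁻¹).1 * (g (Q.tgt l)).1 = 1 := Units.inv_mul _
      simp only [Matrix.mul_assoc]
      rw [← Matrix.mul_assoc _ (g (Q.tgt l)).1, h0, Matrix.one_mul]
    · rw [contractMat, contractMat, dif_neg c₁, dif_neg c₁, dif_neg c₂, dif_neg c₂, key _ c₂,
        key' _ c₁, smul_apply]

theorem contractMap_smul {ν : (contract hC).Dim} (g : Q.Grp K (extDim hC ν))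
    (x : Q.RepSpace K (extDim hC ν)) :
    contractMap hC (g • x) = projG hC g • contractMap hC x := by
  refine RepSpace.ext (funext fun l => ?_)
  have hl : ¬ (Q.src l.1 ∈ Q.orbit (Q.tgt e) ∧ Q.tgt l.1 ∈ Q.orbit (Q.tgt e)) := fun ⟨h₁, h₂⟩ => by
    by_cases h : Q.src l.1 = Q.tgt l.1
    · exact src_ne_of_loops hC.loops_tgt h₁ l.1 rfl h.symm
    · exact Q.admissible _ h (h₁.symm.trans h₂)
  rw [smul_apply, projG_apply, projG_inv_apply]
  simp only [contractMap]
  rw [contractMat_smul hC g x hl, castM_mul _ (extDim_src hC ν l),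
    castM_mul _ (extDim_tgt hC ν l), castM_castM, castM_castM]
  rfl

theorem smul_mem_heart {ν : Q.Dim} (g : Q.Grp K ν) {x : Q.RepSpace K ν}
    (hx : x ∈ heart e ν) : g • x ∈ heart e ν := fun h hh => by
  have hb : ∀ i, Function.Bijective (g i).1.mulVec := fun i =>
    ⟨Matrix.mulVec_injective_iff_isUnit.2 (g i).isUnit,
      Matrix.mulVec_surjective_iff_isUnit.2 (g i).isUnit⟩
  have h1 : ((g • x).mat h).mulVec =
      (g (Q.tgt h)).1.mulVec ∘ (x.mat h).mulVec ∘ ((g⁻¹) (Q.src h)).1.mulVec := by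
    funext v
    simp [smul_apply, Matrix.mulVec_mulVec, Matrix.mul_assoc]
  rw [h1]
  exact (hb _).comp ((hx h hh).comp ⟨Matrix.mulVec_injective_iff_isUnit.2 (g⁻¹ _).isUnit,
    Matrix.mulVec_surjective_iff_isUnit.2 (g⁻¹ _).isUnit⟩)

/-- `E_V^{♡, F}`. -/
abbrev HeartF (ν : (contract hC).Dim) : Type _ :=
  {x : RepF (Q := Q) φ (extDim hC ν) // x.1 ∈ heart e (extDim hC ν)}

/-- The space `H_ν^♡` of `G_V^F`-invariant functions on `E_V^{♡, F}`. -/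
def heartSpace (R : Type*) [Field R] (ν : (contract hC).Dim) :
    Submodule R (HeartF hC φ ν → R) where
  carrier := {f | ∀ (g : GrpF (Q := Q) φ (extDim hC ν)) (x y : HeartF hC φ ν),
    g.1 • x.1.1 = y.1.1 → f y = f x}
  add_mem' := fun hf hf' g x y h => by simp [hf g x y h, hf' g x y h]
  zero_mem' := fun _ _ _ _ => rfl
  smul_mem' := fun c f hf g x y h => by simp [hf g x y h]

/-- The contraction map `μ_ν : E_V^{♡, F} → E_V̂^F`. -/
def mu (ν : (contract hC).Dim) (x : HeartF hC φ ν) : RepF (Q := contract hC) φ ν :=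
  fixMap (contractMap hC) (contractMap_frob hC φ) x.1

/-- The pullback `μ_ν^*`. -/
def muPull (R : Type*) [Field R] (ν : (contract hC).Dim) :
    hallSpace (Q := contract hC) φ R ν →ₗ[R] heartSpace hC φ R ν where
  toFun f := ⟨fun x => f.1 (mu hC φ ν x), fun g x y h =>
    f.2 ⟨projG hC g.1, by
      show frobG φ (projG hC g.1) = projG hC g.1
      rw [← projG_frob, show frobG φ g.1 = g.1 from g.2]⟩ _ _ (by
        show projG hC g.1 • contractMap hC x.1.1 = contractMap hC y.1.1
        rw [← contractMap_smul, h])⟩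
  map_add' _ _ := rfl
  map_smul' _ _ := rfl

/-- The twisted pullback `μ_ν^⋆ = (q^{-1/2})^{ν_{i₋}² φ₁(i₋)} μ_ν^*`. -/
def muStar (ν : (contract hC).Dim) :
    hallSpace (Q := contract hC) φ R ν →ₗ[R] heartSpace hC φ R ν :=
  (s⁻¹ ^ (extDim hC ν (Q.orb (Q.tgt e)) ^ 2 * Q.φ₁ (Q.tgt e))) • muPull hC φ R ν

open Classical in
/-- Extension by zero `(j_ν)_! : H_ν^♡ → H_ν`. -/
def jShriek (R : Type*) [Field R] (ν : (contract hC).Dim) :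
    heartSpace hC φ R ν →ₗ[R] hallSpace (Q := Q) φ R (extDim hC ν) where
  toFun f := ⟨fun x => if hx : x.1 ∈ heart e (extDim hC ν) then f.1 ⟨x, hx⟩ else 0,
    fun g x y h => by
      by_cases hx : x.1 ∈ heart e (extDim hC ν)
      · have hy : y.1 ∈ heart e (extDim hC ν) := h ▸ smul_mem_heart g.1 hx
        simp only [dif_pos hx, dif_pos hy]
        exact f.2 g ⟨x, hx⟩ ⟨y, hy⟩ h
      · have hy : y.1 ∉ heart e (extDim hC ν) := fun hy => hx (by
          have := smul_mem_heart g.1⁻¹ hy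
          rwa [← h, inv_smul_smul] at this)
        simp only [dif_neg hx, dif_neg hy]⟩
  map_add' f f' := Subtype.ext <| funext fun x => by
    by_cases hx : x.1 ∈ heart e (extDim hC ν) <;> simp [hx]
  map_smul' c f := Subtype.ext <| funext fun x => by
    by_cases hx : x.1 ∈ heart e (extDim hC ν) <;> simp [hx]

/-- `H^♡ = ⨁_{ν ∈ ℕ[Î]} H_ν^♡`. -/
abbrev HeartHall (R : Type*) [Field R] : Type _ := ⨁ ν : (contract hC).Dim, heartSpace hC φ R ν

/-- `μ^⋆ : Ĥ → H^♡`. -/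
def muStarHall : (contract hC).HallAlgebra φ s →ₗ[R] HeartHall hC φ R :=
  DirectSum.lmap fun ν => muStar hC φ s ν

open Classical in
/-- `j_! : H^♡ → H`. -/
def jShriekHall : HeartHall hC φ R →ₗ[R] Q.HallAlgebra φ s :=
  DirectSum.toModule R _ _ fun ν => Q.hallOf φ s (extDim hC ν) ∘ₗ jShriek hC φ R ν

/-- `ψ = j_! ∘ μ^⋆`. -/
def psi : (contract hC).HallAlgebra φ s →ₗ[R] Q.HallAlgebra φ s :=
  jShriekHall hC φ s ∘ₗ muStarHall hC φ s

end embedding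

end AdmissibleQuiver

/-- The Frobenius map `x ↦ x^q`, `q = p^n`, of the algebraic closure of `𝔽_p`. -/
abbrev Fr (p : ℕ) [Fact p.Prime] (n : ℕ) :
    AlgebraicClosure (ZMod p) →+* AlgebraicClosure (ZMod p) :=
  iterateFrobenius (AlgebraicClosure (ZMod p)) p n

/-- The field `ℚ(s)`, a subfield of `ℂ`. -/
abbrev Coeff (s : ℂ) : Type := IntermediateField.adjoin ℚ {s}

/-- The number `s` as an element of `ℚ(s)`. -/
abbrev root (s : ℂ) : Coeff s := IntermediateField.AdjoinSimple.gen ℚ s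

end HallContraction
end

/-!
The contraction map has an equivariant section, the inflation, that lets every `h_k` act by the
identity, and every `x` with all `x_{h_k}` invertible is moved to the inflation of its contraction
by an element of the kernel of `G_V → G_V̂`, which can be chosen `F`-fixed when `x` is. Both sides
of `ψ(f ∘ g) = ψ(f) ∘ ψ(g)` vanish at `x` unless all `x_{h_k}` are invertible, because a block
triangular matrix is invertible if and only if its diagonal blocks are. It therefore suffices to
compare them at inflations.

Since `E' → E''` is a torsor under `G_T × G_W`, the fibre of `p₃ p₂` over an inflation is the
product of the corresponding fibre for the contracted graph with the `F`-fixed part of the kernel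
of `G_T × G_W → G_T̂ × G_Ŵ`. The order of that kernel is the ratio of the normalizing factors
`#(G_T^F × G_W^F)`. The powers of `q^{1/2}` agree because `m_Ω(τ, ω)` exceeds its analogue for the
contracted graph by `2 φ τ_{i₋} ω_{i₋}`, the contracted vertices and edges contributing equally,
and this is the cross term in `(τ + ω)_{i₋}² φ`.
-/

noncomputable section

namespace HallContraction

namespace AdmissibleQuiver

section blockMatrices

variable {K : Type*} [Field K] {a b c d : ℕ}

theorem MapsW.submatrix_eq_fromBlocks {A : Matrix (Fin (a + b)) (Fin (c + d)) K}
    (hA : MapsW a b c d A) :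
    A.submatrix finSumFinEquiv finSumFinEquiv =
      Matrix.fromBlocks (blockT a b c d A) 0
        (A.submatrix (Fin.natAdd a) (Fin.castAdd d)) (blockW a b c d A) := by
  ext (i | i) (j | j)
  · simp [blockT]
  · simpa using hA i j
  · simp
  · simp [blockW]

theorem MapsW.isUnit_iff {A : Matrix (Fin (a + b)) (Fin (a + b)) K} (hA : MapsW a b a b A) :
    IsUnit A ↔ IsUnit (blockT a b a b A) ∧ IsUnit (blockW a b a b A) := by
  rw [← Matrix.isUnit_submatrix_equiv finSumFinEquiv finSumFinEquiv, hA.submatrix_eq_fromBlocks,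
    Matrix.isUnit_fromBlocks_zero₁₂]

theorem MapsW.inv {g : GL (Fin (a + b)) K} (hg : MapsW a b a b g.1) : MapsW a b a b (g⁻¹).1 := by
  obtain ⟨hT, hW⟩ := hg.isUnit_iff.1 g.isUnit
  intro i j
  have h := congrFun₂ (Matrix.inv_submatrix_equiv g.1 finSumFinEquiv finSumFinEquiv)
    (Sum.inl i) (Sum.inr j)
  rw [hg.submatrix_eq_fromBlocks,
    Matrix.inv_fromBlocks_zero₁₂_of_isUnit_iff _ _ _ (iff_of_true hT hW)] at h
  rw [Matrix.coe_units_inv]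
  simpa using h.symm

theorem mapsW_castM_one (ha : c = a) (hb : d = b) (h : c + d = a + b) :
    MapsW c d a b (castM h rfl (1 : Matrix (Fin (a + b)) (Fin (a + b)) K)) := by
  subst ha hb
  exact mapsW_one _ _

theorem blockT_castM_one (ha : c = a) (hb : d = b) (h : c + d = a + b) :
    blockT c d a b (castM h rfl (1 : Matrix (Fin (a + b)) (Fin (a + b)) K)) = castM ha rfl 1 := by
  subst ha hb
  exact blockT_one _ _

theorem blockW_castM_one (ha : c = a) (hb : d = b) (h : c + d = a + b) :
    blockW c d a b (castM h rfl (1 : Matrix (Fin (a + b)) (Fin (a + b)) K)) = castM hb rfl 1 := by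
  subst ha hb
  exact blockW_one _ _

/-- The block diagonal matrix with blocks `A` and `B`, in the coordinates of `V = T ⊕ W`. -/
def leviMat (A : Matrix (Fin a) (Fin a) K) (B : Matrix (Fin b) (Fin b) K) :
    Matrix (Fin (a + b)) (Fin (a + b)) K :=
  (Matrix.fromBlocks A 0 0 B).submatrix finSumFinEquiv.symm finSumFinEquiv.symm

theorem mapsW_leviMat (A : Matrix (Fin a) (Fin a) K) (B : Matrix (Fin b) (Fin b) K) :
    MapsW a b a b (leviMat A B) := fun i j => by
  simp [leviMat]

theorem blockT_leviMat (A : Matrix (Fin a) (Fin a) K) (B : Matrix (Fin b) (Fin b) K) :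
    blockT a b a b (leviMat A B) = A := by
  ext i j
  simp [blockT, leviMat]

theorem blockW_leviMat (A : Matrix (Fin a) (Fin a) K) (B : Matrix (Fin b) (Fin b) K) :
    blockW a b a b (leviMat A B) = B := by
  ext i j
  simp [blockW, leviMat]

theorem leviMat_one :
    leviMat (1 : Matrix (Fin a) (Fin a) K) (1 : Matrix (Fin b) (Fin b) K) = 1 := by
  rw [leviMat, Matrix.fromBlocks_one, Matrix.submatrix_one_equiv]

theorem leviMat_mul (A A' : Matrix (Fin a) (Fin a) K) (B B' : Matrix (Fin b) (Fin b) K) :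
    leviMat (A * A') (B * B') = leviMat A B * leviMat A' B' := by
  simp [leviMat, Matrix.submatrix_mul_equiv, Matrix.fromBlocks_multiply]

theorem castM_leviMat {a' b' : ℕ} (ha : a' = a) (hb : b' = b) (h h' : a' + b' = a + b)
    (A : Matrix (Fin a) (Fin a) K) (B : Matrix (Fin b) (Fin b) K) (φ : K →+* K) :
    castM h h' ((leviMat A B).map φ) = leviMat (castM ha ha (A.map φ)) (castM hb hb (B.map φ)) := by
  subst ha hb
  ext i j
  refine Fin.addCases (fun i => ?_) (fun i => ?_) i <;>
    refine Fin.addCases (fun j => ?_) (fun j => ?_) j <;> simp [leviMat, castM]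

/-- The embedding `GL_a × GL_b → GL_{a+b}` as block diagonal matrices. -/
def leviGL : GL (Fin a) K × GL (Fin b) K →* GL (Fin (a + b)) K where
  toFun g := ⟨leviMat g.1.1 g.2.1, leviMat (g.1⁻¹).1 (g.2⁻¹).1,
    by rw [← leviMat_mul, Units.mul_inv, Units.mul_inv, leviMat_one],
    by rw [← leviMat_mul, Units.inv_mul, Units.inv_mul, leviMat_one]⟩
  map_one' := Units.ext leviMat_one
  map_mul' _ _ := Units.ext (leviMat_mul _ _ _ _)

end blockMatrices

section leviQuotient

variable {ι Ω : Type*} {Q : AdmissibleQuiver ι Ω} {K : Type*} [Field K] {τ ω : Q.Dim}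

/-- The condition that `x ∈ E_V` leaves `W` invariant, where `V = T ⊕ W`; it defines `S_W`. -/
def LeavesW (x : Q.RepSpace K (τ + ω)) : Prop :=
  ∀ h, MapsW (τ (Q.orb (Q.tgt h))) (ω (Q.orb (Q.tgt h))) (τ (Q.orb (Q.src h)))
    (ω (Q.orb (Q.src h))) (x.mat h)

theorem mem_parabolic_iff {g : Q.Grp K (τ + ω)} :
    g ∈ parabolic K τ ω ↔
      ∀ i, MapsW (τ (Q.orb i)) (ω (Q.orb i)) (τ (Q.orb i)) (ω (Q.orb i)) (g i).1 :=
  ⟨fun hg i => (hg i).1, fun hg i => ⟨hg i, (hg i).inv⟩⟩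

theorem LeavesW.smul {b : Q.Grp K (τ + ω)} (hb : b ∈ parabolic K τ ω) {x : Q.RepSpace K (τ + ω)}
    (hx : LeavesW x) : LeavesW (b • x) := fun h =>
  ((hb (Q.tgt h)).1.mul (hx h)).mul (hb (Q.src h)).2

/-- The map from the stabilizer of `W` to `G_T × G_W`, whose kernel is the unipotent radical. -/
def leviPart : parabolic K τ ω →* Q.Grp K τ × Q.Grp K ω where
  toFun b :=
    (fun i =>
      { val := blockT _ _ _ _ (b.1 i).1
        inv := blockT _ _ _ _ ((b.1 i)⁻¹).1
        val_inv := by rw [← blockT_mul (b.2 i).1, Units.mul_inv, blockT_one]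
        inv_val := by rw [← blockT_mul (b.2 i).2, Units.inv_mul, blockT_one] },
    fun i =>
      { val := blockW _ _ _ _ (b.1 i).1
        inv := blockW _ _ _ _ ((b.1 i)⁻¹).1
        val_inv := by rw [← blockW_mul (b.2 i).2, Units.mul_inv, blockW_one]
        inv_val := by rw [← blockW_mul (b.2 i).1, Units.inv_mul, blockW_one] })
  map_one' := Prod.ext (funext fun _ => Units.ext (blockT_one _ _))
    (funext fun _ => Units.ext (blockW_one _ _))
  map_mul' b b' := Prod.ext (funext fun i => Units.ext (blockT_mul (b.2 i).1))
    (funext fun i => Units.ext (blockW_mul (b'.2 i).1))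

theorem mem_unipotent_iff_leviPart_eq_one (b : parabolic K τ ω) :
    b.1 ∈ unipotent K τ ω ↔ leviPart b = 1 := by
  refine ⟨fun hb => Prod.ext (funext fun i => Units.ext (hb.2 i).1)
    (funext fun i => Units.ext (hb.2 i).2), fun hb => ⟨b.2, fun i => ⟨?_, ?_⟩⟩⟩
  · exact congrArg Units.val (congrFun (congrArg Prod.fst hb) i)
  · exact congrArg Units.val (congrFun (congrArg Prod.snd hb) i)

theorem partT_smul_of_mem_parabolic (b : parabolic K τ ω) {x : Q.RepSpace K (τ + ω)}
    (hx : LeavesW x) : partT (b.1 • x) = (leviPart b).1 • partT x :=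
  RepSpace.ext <| funext fun h =>
    (blockT_mul ((b.2 (Q.tgt h)).1.mul (hx h))).trans
      (congrArg (· * _) (blockT_mul (b.2 (Q.tgt h)).1))

theorem partW_smul_of_mem_parabolic (b : parabolic K τ ω) {x : Q.RepSpace K (τ + ω)}
    (hx : LeavesW x) : partW (b.1 • x) = (leviPart b).2 • partW x :=
  RepSpace.ext <| funext fun h =>
    (blockW_mul (b.2 (Q.src h)).2).trans (congrArg (· * _) (blockW_mul (hx h)))

/-- The embedding of `G_T × G_W` into the stabilizer of `W` by block diagonal matrices. -/
def levi : Q.Grp K τ × Q.Grp K ω →* parabolic K τ ω where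
  toFun l := ⟨fun i => leviGL (l.1 i, l.2 i), mem_parabolic_iff.2 fun _ => mapsW_leviMat _ _⟩
  map_one' := Subtype.ext (funext fun _ => map_one leviGL)
  map_mul' l l' := Subtype.ext (funext fun i => map_mul leviGL (l.1 i, l.2 i) (l'.1 i, l'.2 i))

theorem leviPart_levi (l : Q.Grp K τ × Q.Grp K ω) : leviPart (levi l) = l :=
  Prod.ext (funext fun _ => Units.ext (blockT_leviMat _ _))
    (funext fun _ => Units.ext (blockW_leviMat _ _))

theorem frobG_levi (φ : K →+* K) (l : Q.Grp K τ × Q.Grp K ω) :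
    frobG φ (levi l).1 = (levi (frobG φ l.1, frobG φ l.2)).1 :=
  funext fun _ => Units.ext (castM_leviMat (by rw [Q.orb_aV]) (by rw [Q.orb_aV]) _ _ _ _ φ)

end leviQuotient

section torsor

variable {ι Ω : Type*} {Q : AdmissibleQuiver ι Ω} {K : Type*} [Field K] {τ ω : Q.Dim}

theorem levi_conj_mem_unipotent (l : Q.Grp K τ × Q.Grp K ω) {u : Q.Grp K (τ + ω)}
    (hu : u ∈ unipotent K τ ω) : (levi l).1 * u * ((levi l).1)⁻¹ ∈ unipotent K τ ω := by
  have hu' := (mem_unipotent_iff_leviPart_eq_one ⟨u, hu.1⟩).1 hu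
  refine (mem_unipotent_iff_leviPart_eq_one (levi l * ⟨u, hu.1⟩ * (levi l)⁻¹)).2 ?_
  rw [map_mul, map_mul, hu', mul_one, map_inv, mul_inv_cancel]

instance : SMul (Q.Grp K τ × Q.Grp K ω) (EPrime K τ ω) where
  smul l := Quotient.map
    (fun z => (z.1 * ((levi l).1)⁻¹, ⟨(levi l).1 • z.2.1, LeavesW.smul (levi l).2 z.2.2⟩))
    fun z _ ⟨u, hu, h1, h2⟩ => ⟨_, levi_conj_mem_unipotent l hu, by simp [h1, mul_assoc], by
      simp only [h2, mul_smul, inv_smul_smul]⟩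

/-- The action `l • [g, x] = [g l⁻¹, l.x]` of `G_T × G_W` on `E'`. -/
instance : MulAction (Q.Grp K τ × Q.Grp K ω) (EPrime K τ ω) where
  one_smul := by
    rintro ⟨z⟩
    refine congrArg (Quotient.mk _) (Prod.ext ?_ (Subtype.ext ?_))
    · change z.1 * ((levi 1).1)⁻¹ = z.1
      rw [map_one, Subgroup.coe_one, inv_one, mul_one]
    · change (levi 1).1 • z.2.1 = z.2.1
      rw [map_one, Subgroup.coe_one, one_smul]
  mul_smul l l' := by
    rintro ⟨z⟩
    refine congrArg (Quotient.mk _) (Prod.ext ?_ (Subtype.ext ?_))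
    · change z.1 * ((levi (l * l')).1)⁻¹ = z.1 * ((levi l').1)⁻¹ * ((levi l).1)⁻¹
      rw [map_mul, Subgroup.coe_mul, mul_inv_rev, mul_assoc]
    · change (levi (l * l')).1 • z.2.1 = (levi l).1 • (levi l').1 • z.2.1
      rw [map_mul, Subgroup.coe_mul, mul_smul]

theorem p₂_smul (l : Q.Grp K τ × Q.Grp K ω) (z : EPrime K τ ω) : p₂ (l • z) = p₂ z := by
  obtain ⟨z, rfl⟩ := Quotient.exists_rep z
  exact (Quotient.sound ⟨(levi l).1, (levi l).2, rfl, rfl⟩ : (_ : EDoublePrime K τ ω) = _).symm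

theorem p₁T_smul (l : Q.Grp K τ × Q.Grp K ω) (z : EPrime K τ ω) :
    p₁T (l • z) = l.1 • p₁T z := by
  obtain ⟨z, rfl⟩ := Quotient.exists_rep z
  refine (partT_smul_of_mem_parabolic (levi l) z.2.2).trans ?_
  rw [leviPart_levi]
  rfl

theorem p₁W_smul (l : Q.Grp K τ × Q.Grp K ω) (z : EPrime K τ ω) :
    p₁W (l • z) = l.2 • p₁W z := by
  obtain ⟨z, rfl⟩ := Quotient.exists_rep z
  refine (partW_smul_of_mem_parabolic (levi l) z.2.2).trans ?_
  rw [leviPart_levi]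
  rfl

theorem frobE'_smul (φ : K →+* K) (l : Q.Grp K τ × Q.Grp K ω) (z : EPrime K τ ω) :
    frobE' φ (l • z) = (frobG φ l.1, frobG φ l.2) • frobE' φ z := by
  obtain ⟨z, rfl⟩ := Quotient.exists_rep z
  refine congrArg (Quotient.mk _) (Prod.ext ?_ (Subtype.ext ?_))
  · change frobG φ (z.1 * ((levi l).1)⁻¹) = frobG φ z.1 * _
    rw [map_mul, map_inv, frobG_levi]
  · change frob φ ((levi l).1 • z.2.1) = _ • frob φ z.2.1
    rw [frob_smul, frobG_levi]

theorem eq_one_of_smul_eq_self {l : Q.Grp K τ × Q.Grp K ω} {z : EPrime K τ ω} (h : l • z = z) :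
    l = 1 := by
  obtain ⟨z, rfl⟩ := Quotient.exists_rep z
  obtain ⟨u, hu, h1, -⟩ := Quotient.exact h
  have hul : u = ((levi l).1)⁻¹ := by
    rw [mul_assoc, left_eq_mul, mul_eq_one_iff_eq_inv, inv_inv] at h1
    exact h1.symm
  have hl := (mem_unipotent_iff_leviPart_eq_one ⟨u, hu.1⟩).1 hu
  rw [show (⟨u, hu.1⟩ : parabolic K τ ω) = (levi l)⁻¹ from Subtype.ext hul, map_inv,
    leviPart_levi, inv_eq_one] at hl
  exact hl

theorem smul_left_injective_EPrime (z : EPrime K τ ω) :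
    Function.Injective fun l : Q.Grp K τ × Q.Grp K ω => l • z := fun l l' h => by
  have : (l'⁻¹ * l) • z = z := by rw [mul_smul, show l • z = l' • z from h, inv_smul_smul]
  exact (inv_mul_eq_one.1 (eq_one_of_smul_eq_self this)).symm

theorem exists_smul_eq_of_p₂_eq {z z' : EPrime K τ ω} (h : p₂ z = p₂ z') :
    ∃ l : Q.Grp K τ × Q.Grp K ω, l • z = z' := by
  obtain ⟨z, rfl⟩ := Quotient.exists_rep z
  obtain ⟨z', rfl⟩ := Quotient.exists_rep z'
  obtain ⟨b, hb, h1, h2⟩ := Quotient.exact h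
  let l := leviPart ⟨b, hb⟩
  have hu : b * ((levi l).1)⁻¹ ∈ unipotent K τ ω :=
    (mem_unipotent_iff_leviPart_eq_one (⟨b, hb⟩ * (levi l)⁻¹)).2 (by
      rw [map_mul, map_inv, leviPart_levi, mul_inv_cancel])
  refine ⟨l, Quotient.sound ⟨_, hu, ?_, ?_⟩⟩
  · exact h1.trans (by simp)
  · exact h2.trans (by simp [mul_smul])

theorem p₂_surjective : Function.Surjective (p₂ (K := K) (τ := τ) (ω := ω)) := by
  rintro ⟨z⟩
  exact ⟨Quotient.mk _ z, rfl⟩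

end torsor

section inflation

variable {ι Ω : Type*} {Q : AdmissibleQuiver ι Ω} [Finite ι] [Finite Ω] {e : Ω}
variable (hC : Q.IsContractible e) {K : Type*} [Field K] (φ : K →+* K)
variable {ν : (contract hC).Dim}

theorem fold_tgt_eq_fold_src {h : Ω} (hh : Q.aE.SameCycle e h) :
    fold hC (Q.tgt h) = fold hC (Q.src h) := Subtype.ext <| by
  rw [fold_of_mem hC (tgt_mem hh), fold_of_notMem hC (hC.disjoint (src_mem hh)),
    hC.eq_of_tgt (Q.leg_sameCycle e (tgt_mem hh)) hh (Q.tgt_leg e (tgt_mem hh))]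

theorem extDim_tgt_eq_src (ν : (contract hC).Dim) {h : Ω} (hh : Q.aE.SameCycle e h) :
    extDim hC ν (Q.orb (Q.tgt h)) = extDim hC ν (Q.orb (Q.src h)) := by
  rw [extDim_orb, extDim_orb, fold_tgt_eq_fold_src hC hh]

/-- The projection `projG : G_V → G_V̂` as a group homomorphism. -/
def projHom : Q.Grp K (extDim hC ν) →* (contract hC).Grp K ν where
  toFun := projG hC
  map_one' := funext fun i => map_one (glMap (extDim_val hC ν i) (RingHom.id K))
  map_mul' g g' :=
    funext fun i => map_mul (glMap (extDim_val hC ν i) (RingHom.id K)) (g i.1) (g' i.1)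

theorem projHom_frobG (g : Q.Grp K (extDim hC ν)) :
    projHom hC (frobG φ g) = frobG φ (projHom hC g) :=
  projG_frob hC φ g

/-- The embedding `G_V̂ → G_V` that repeats the component at `h_k'` at the vertex `h_k''`. -/
def diag : (contract hC).Grp K ν →* Q.Grp K (extDim hC ν) where
  toFun g := fun i => g (fold hC i)
  map_one' := rfl
  map_mul' _ _ := rfl

theorem projHom_diag (g : (contract hC).Grp K ν) : projHom hC (diag hC g) = g :=
  funext fun i => Units.ext <| castM_family (fun i => (g i).1) (fold_eq hC i) _ _ rfl rfl

theorem diag_injective : Function.Injective (diag (K := K) (ν := ν) hC) :=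
  Function.LeftInverse.injective (projHom_diag hC)

theorem diag_projHom_apply (g : Q.Grp K (extDim hC ν)) {i : ι} (hi : i ∉ Q.orbit (Q.tgt e)) :
    diag hC (projHom hC g) i = g i :=
  Units.ext <| castM_family (fun i => (g i).1) (fold_of_notMem hC hi) _ _ rfl rfl

theorem diag_frobG (g : (contract hC).Grp K ν) : diag hC (frobG φ g) = frobG φ (diag hC g) :=
  funext fun i => Units.ext <|
    castM_family (fun i => (g i).1.map φ) (Subtype.ext (fold_aV hC i).symm) _ _ _ _

open Classical in
/-- The section `E_V̂ → E_V^♡` of the contraction map for which all `h_k` act by the identity. -/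
def inflate (x : (contract hC).RepSpace K ν) : Q.RepSpace K (extDim hC ν) :=
  ⟨fun l => if h : Q.aE.SameCycle e l then castM (extDim_tgt_eq_src hC ν h) rfl 1
    else x.mat ⟨l, h⟩⟩

theorem inflate_of_sameCycle (x : (contract hC).RepSpace K ν) {l : Ω} (h : Q.aE.SameCycle e l) :
    (inflate hC x).mat l = castM (extDim_tgt_eq_src hC ν h) rfl 1 :=
  dif_pos h

theorem inflate_of_not_sameCycle (x : (contract hC).RepSpace K ν) {l : Ω}
    (h : ¬ Q.aE.SameCycle e l) : (inflate hC x).mat l = x.mat ⟨l, h⟩ :=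
  dif_neg h

theorem legMat_inflate (x : (contract hC).RepSpace K ν) {i : ι} (hi : i ∈ Q.orbit (Q.tgt e)) :
    legMat hC (inflate hC x) hi = 1 := by
  rw [legMat, inflate_of_sameCycle hC _ (Q.leg_sameCycle e hi), castM_castM, castM_one]

theorem contractMap_inflate (x : (contract hC).RepSpace K ν) :
    contractMap hC (inflate hC x) = x := RepSpace.ext <| funext fun l => by
  change contractMat hC (inflate hC x) l.1 = x.mat l
  rw [← inflate_of_not_sameCycle hC x l.2, contractMat]
  split_ifs with h₁ h₂
  · rw [legMat_inflate, Matrix.mul_one]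
  · rw [legMat_inflate, inv_one, Matrix.one_mul]
  · rfl

theorem inflate_injective : Function.Injective (inflate (K := K) (ν := ν) hC) :=
  Function.LeftInverse.injective (contractMap_inflate hC)

theorem isUnit_castM_iff_bijective_mulVec {m n k : ℕ} (hm : k = m) (hn : k = n)
    (A : Matrix (Fin m) (Fin n) K) : IsUnit (castM hm hn A) ↔ Function.Bijective A.mulVec := by
  subst hm hn
  exact ⟨fun h => ⟨Matrix.mulVec_injective_iff_isUnit.2 h, Matrix.mulVec_surjective_iff_isUnit.2 h⟩,
    fun h => Matrix.mulVec_injective_iff_isUnit.1 h.1⟩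

theorem mem_heart_iff {x : Q.RepSpace K (extDim hC ν)} :
    x ∈ heart e (extDim hC ν) ↔ ∀ i (hi : i ∈ Q.orbit (Q.tgt e)), IsUnit (legMat hC x hi) := by
  refine ⟨fun hx i hi => (isUnit_castM_iff_bijective_mulVec _ _ _).2 (hx _ (Q.leg_sameCycle e hi)),
    fun hx h hh => ?_⟩
  have hleg : Q.leg e (tgt_mem hh) = h :=
    hC.eq_of_tgt (Q.leg_sameCycle e (tgt_mem hh)) hh (Q.tgt_leg e (tgt_mem hh))
  have hbij := (isUnit_castM_iff_bijective_mulVec _ _ _).1 (hx _ (tgt_mem hh))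
  rwa [hleg] at hbij

theorem inflate_mem_heart (x : (contract hC).RepSpace K ν) :
    inflate hC x ∈ heart e (extDim hC ν) :=
  (mem_heart_iff hC).2 fun _ hi => by
    rw [legMat_inflate]
    exact isUnit_one

theorem mat_eq_castM_legMat (x : Q.RepSpace K (extDim hC ν)) {h : Ω} (hh : Q.aE.SameCycle e h) :
    x.mat h = castM rfl (extDim_tgt_eq_src hC ν hh).symm (legMat hC x (tgt_mem hh)) := by
  rw [legMat, castM_castM]
  exact (castM_family x.mat (hC.eq_of_tgt (Q.leg_sameCycle e (tgt_mem hh)) hh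
    (Q.tgt_leg e (tgt_mem hh))) _ _ rfl rfl).symm

theorem eq_of_legMat_eq_of_contractMap_eq {x y : Q.RepSpace K (extDim hC ν)}
    (hx : x ∈ heart e (extDim hC ν))
    (hleg : ∀ i (hi : i ∈ Q.orbit (Q.tgt e)), legMat hC x hi = legMat hC y hi)
    (hcon : contractMap hC x = contractMap hC y) : x = y := RepSpace.ext <| funext fun l => by
  by_cases hl : Q.aE.SameCycle e l
  · rw [mat_eq_castM_legMat hC x hl, mat_eq_castM_legMat hC y hl, hleg]
  have hmat : contractMat hC x l = contractMat hC y l :=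
    congrFun (congrArg RepSpace.mat hcon) ⟨l, hl⟩
  rw [contractMat, contractMat] at hmat
  split_ifs at hmat with h₁ h₂
  · rw [← hleg] at hmat
    obtain ⟨_⟩ := ((mem_heart_iff hC).1 hx _ h₁).nonempty_invertible
    exact Matrix.mul_left_injective_of_invertible _ hmat
  · rw [← hleg] at hmat
    obtain ⟨_⟩ :=
      (Matrix.isUnit_nonsing_inv_iff.2 ((mem_heart_iff hC).1 hx _ h₂)).nonempty_invertible
    exact Matrix.mul_right_injective_of_invertible _ hmat
  · exact hmat

theorem legMat_diag_smul (g : (contract hC).Grp K ν) (x : Q.RepSpace K (extDim hC ν)) {i : ι}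
    (hi : i ∈ Q.orbit (Q.tgt e)) :
    legMat hC (diag hC g • x) hi =
      (diag hC g i).1 * legMat hC x hi * ((diag hC g i)⁻¹).1 := by
  rw [legMat_smul]
  congr 1
  exact castM_family (fun i => ((g i)⁻¹).1) (fold_eq hC (fold hC i)) _ _ rfl rfl

theorem inflate_smul (g : (contract hC).Grp K ν) (x : (contract hC).RepSpace K ν) :
    inflate hC (g • x) = diag hC g • inflate hC x := by
  refine eq_of_legMat_eq_of_contractMap_eq hC (inflate_mem_heart hC _) (fun i hi => ?_) ?_
  · rw [legMat_diag_smul, legMat_inflate, legMat_inflate, Matrix.mul_one, Units.mul_inv]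
  · rw [contractMap_smul, contractMap_inflate, contractMap_inflate]
    exact congrArg (· • x) (projHom_diag hC g).symm

theorem inflate_frob (x : (contract hC).RepSpace K ν) :
    inflate hC (frob φ x) = frob φ (inflate hC x) := by
  refine eq_of_legMat_eq_of_contractMap_eq hC (inflate_mem_heart hC _) (fun i hi => ?_) ?_
  · rw [legMat_frob hC φ _ rfl hi (aV_mem_orbit.2 hi) (by rw [Q.orb_aV]), legMat_inflate,
      legMat_inflate, Matrix.map_one φ (map_zero φ) (map_one φ), castM_one]
  · rw [contractMap_frob, contractMap_inflate, contractMap_inflate]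

theorem diag_projHom_of_smul_inflate_eq {g : Q.Grp K (extDim hC ν)}
    {x y : (contract hC).RepSpace K ν} (h : g • inflate hC x = inflate hC y) :
    diag hC (projHom hC g) = g := funext fun i => by
  by_cases hi : i ∈ Q.orbit (Q.tgt e)
  · have hleg := legMat_smul hC g (inflate hC x) hi
    rw [h, legMat_inflate, legMat_inflate, Matrix.mul_one] at hleg
    have hinv : castM (extDim_fold hC ν i) (extDim_fold hC ν i) ((g (fold hC i).1)⁻¹).1 =
        ((diag hC (projHom hC g) i)⁻¹).1 := (projG_inv_apply hC g (fold hC i)).symm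
    rw [hinv] at hleg
    have hone : g i * (diag hC (projHom hC g) i)⁻¹ = 1 := Units.ext hleg.symm
    exact (mul_inv_eq_one.1 hone).symm
  · exact diag_projHom_apply hC g hi

open Classical in
/-- The element of `G_V` with components `x_{h_k}` at the vertices `h_k''` and `1` elsewhere. It
moves the inflation of `x̂` to `x`. -/
def legGrp {x : Q.RepSpace K (extDim hC ν)} (hx : x ∈ heart e (extDim hC ν)) :
    Q.Grp K (extDim hC ν) := fun i =>
  if hi : i ∈ Q.orbit (Q.tgt e) then ((mem_heart_iff hC).1 hx i hi).unit else 1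

theorem legGrp_of_mem {x : Q.RepSpace K (extDim hC ν)} (hx : x ∈ heart e (extDim hC ν)) {i : ι}
    (hi : i ∈ Q.orbit (Q.tgt e)) : (legGrp hC hx i).1 = legMat hC x hi := by
  rw [legGrp, dif_pos hi, IsUnit.unit_spec]

theorem legGrp_of_notMem {x : Q.RepSpace K (extDim hC ν)} (hx : x ∈ heart e (extDim hC ν)) {i : ι}
    (hi : i ∉ Q.orbit (Q.tgt e)) : legGrp hC hx i = 1 :=
  dif_neg hi

theorem projHom_legGrp {x : Q.RepSpace K (extDim hC ν)} (hx : x ∈ heart e (extDim hC ν)) :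
    projHom hC (legGrp hC hx) = 1 := funext fun i => Units.ext <| by
  refine (projG_apply hC _ i).trans ?_
  rw [legGrp_of_notMem hC hx i.2, Units.val_one, castM_one]
  rfl

theorem legGrp_smul_inflate {x : Q.RepSpace K (extDim hC ν)} (hx : x ∈ heart e (extDim hC ν)) :
    legGrp hC hx • inflate hC (contractMap hC x) = x := by
  refine eq_of_legMat_eq_of_contractMap_eq hC
    (smul_mem_heart _ (inflate_mem_heart hC _)) (fun i hi => ?_) ?_
  · rw [legMat_smul, legMat_inflate, Matrix.mul_one, legGrp_of_mem hC hx hi,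
      legGrp_of_notMem hC hx (fold hC i).2, inv_one, Units.val_one, castM_one, Matrix.mul_one]
  · rw [contractMap_smul, contractMap_inflate]
    exact (congrArg (· • _) (projHom_legGrp hC hx)).trans (one_smul _ _)

theorem frobG_legGrp {x : Q.RepSpace K (extDim hC ν)} (hx : x ∈ heart e (extDim hC ν))
    (hF : frob φ x = x) : frobG φ (legGrp hC hx) = legGrp hC hx :=
  funext fun i => Units.ext <| by
  rw [frobG_apply]
  by_cases hi : i ∈ Q.orbit (Q.tgt e)
  · have hleg := legMat_frob hC φ x rfl hi (aV_mem_orbit.2 hi) (by rw [Q.orb_aV])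
    rw [hF] at hleg
    rw [legGrp_of_mem hC hx hi, legGrp_of_mem hC hx (aV_mem_orbit.2 hi), hleg]
  · rw [legGrp_of_notMem hC hx hi, legGrp_of_notMem hC hx (mt aV_mem_orbit.1 hi), Units.val_one,
      Units.val_one, Matrix.map_one φ (map_zero φ) (map_one φ), castM_one]

end inflation

section inflateSum

variable {ι Ω : Type*} {Q : AdmissibleQuiver ι Ω} [Finite ι] [Finite Ω] {e : Ω}
variable (hC : Q.IsContractible e) {K : Type*} [Field K] (φ : K →+* K)
variable {τ ω : (contract hC).Dim}

/-- `inflate` on `T̂ ⊕ Ŵ`, with values in the representations on `T ⊕ W`. The dimension vectors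
`extDim (τ + ω)` and `extDim τ + extDim ω` agree by unfolding only; spelling out the second one lets
`partT`, `partW` and `parabolic` be applied. -/
def inflateSum (x : (contract hC).RepSpace K (τ + ω)) :
    Q.RepSpace K (extDim hC τ + extDim hC ω) :=
  inflate hC x

/-- `diag` on the automorphisms of `T̂ ⊕ Ŵ`, with values in the automorphisms of `T ⊕ W`. -/
def diagSum : (contract hC).Grp K (τ + ω) →* Q.Grp K (extDim hC τ + extDim hC ω) :=
  diag hC

theorem inflateSum_injective : Function.Injective (inflateSum (K := K) (τ := τ) (ω := ω) hC) :=
  inflate_injective hC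

theorem diagSum_injective : Function.Injective (diagSum (K := K) (τ := τ) (ω := ω) hC) :=
  diag_injective hC

theorem inflateSum_smul (g : (contract hC).Grp K (τ + ω)) (x : (contract hC).RepSpace K (τ + ω)) :
    inflateSum hC (g • x) = diagSum hC g • inflateSum hC x :=
  inflate_smul hC g x

theorem inflateSum_frob (x : (contract hC).RepSpace K (τ + ω)) :
    inflateSum hC (frob φ x) = frob φ (inflateSum hC x) :=
  inflate_frob hC φ x

theorem diagSum_frobG (g : (contract hC).Grp K (τ + ω)) :
    diagSum hC (frobG φ g) = frobG φ (diagSum hC g) :=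
  diag_frobG hC φ g

theorem inflateSum_mem_heart (x : (contract hC).RepSpace K (τ + ω)) :
    inflateSum hC x ∈ heart e (extDim hC τ + extDim hC ω) :=
  inflate_mem_heart hC x

theorem exists_diagSum_eq_of_smul_inflateSum_eq {g : Q.Grp K (extDim hC τ + extDim hC ω)}
    {x y : (contract hC).RepSpace K (τ + ω)} (h : g • inflateSum hC x = inflateSum hC y) :
    ∃ g', diagSum hC g' = g :=
  ⟨projHom hC g, diag_projHom_of_smul_inflate_eq hC h⟩

theorem partT_inflateSum (x : (contract hC).RepSpace K (τ + ω)) :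
    partT (inflateSum hC x) = inflate hC (partT x) := RepSpace.ext <| funext fun l => by
  by_cases hl : Q.aE.SameCycle e l
  · rw [inflate_of_sameCycle hC _ hl]
    exact (congrArg (blockT _ _ _ _) (inflate_of_sameCycle hC x hl)).trans
      (blockT_castM_one (extDim_tgt_eq_src hC τ hl) (extDim_tgt_eq_src hC ω hl) _)
  · rw [inflate_of_not_sameCycle hC _ hl]
    exact congrArg (blockT _ _ _ _) (inflate_of_not_sameCycle hC x hl)

theorem partW_inflateSum (x : (contract hC).RepSpace K (τ + ω)) :
    partW (inflateSum hC x) = inflate hC (partW x) := RepSpace.ext <| funext fun l => by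
  by_cases hl : Q.aE.SameCycle e l
  · rw [inflate_of_sameCycle hC _ hl]
    exact (congrArg (blockW _ _ _ _) (inflate_of_sameCycle hC x hl)).trans
      (blockW_castM_one (extDim_tgt_eq_src hC τ hl) (extDim_tgt_eq_src hC ω hl) _)
  · rw [inflate_of_not_sameCycle hC _ hl]
    exact congrArg (blockW _ _ _ _) (inflate_of_not_sameCycle hC x hl)

theorem leavesW_inflateSum_iff {x : (contract hC).RepSpace K (τ + ω)} :
    LeavesW (inflateSum hC x) ↔ LeavesW x := by
  refine ⟨fun hx l => ?_, fun hx l => ?_⟩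
  · have hmat := inflate_of_not_sameCycle hC x l.2
    exact hmat ▸ hx l.1
  · by_cases hl : Q.aE.SameCycle e l
    · have hmat := inflate_of_sameCycle hC x hl
      exact hmat.symm ▸
        mapsW_castM_one (extDim_tgt_eq_src hC τ hl) (extDim_tgt_eq_src hC ω hl) _
    · have hmat := inflate_of_not_sameCycle hC x hl
      exact hmat.symm ▸ hx ⟨l, hl⟩

theorem diagSum_mem_parabolic_iff {g : (contract hC).Grp K (τ + ω)} :
    diagSum hC g ∈ parabolic K (extDim hC τ) (extDim hC ω) ↔ g ∈ parabolic K τ ω :=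
  ⟨fun hg i => fold_eq hC i ▸ hg i.1, fun hg i => hg (fold hC i)⟩

theorem diagSum_mem_unipotent {g : (contract hC).Grp K (τ + ω)} (hg : g ∈ unipotent K τ ω) :
    diagSum hC g ∈ unipotent K (extDim hC τ) (extDim hC ω) :=
  ⟨(diagSum_mem_parabolic_iff hC).2 hg.1, fun i => hg.2 (fold hC i)⟩

theorem mapsW_legMat {x : Q.RepSpace K (extDim hC τ + extDim hC ω)} (hx : LeavesW x) {i : ι}
    (hi : i ∈ Q.orbit (Q.tgt e)) :
    MapsW (extDim hC τ (Q.orb i)) (extDim hC ω (Q.orb i)) (extDim hC τ (Q.orb i))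
      (extDim hC ω (Q.orb i)) (legMat hC (ν := τ + ω) x hi) :=
  (hx (Q.leg e hi)).castM (extDim_tgt_leg hC τ hi) (extDim_tgt_leg hC ω hi) (extDim_leg hC τ hi)
    (extDim_leg hC ω hi) _ _ (RingHom.id K)

theorem blockT_legMat (x : Q.RepSpace K (extDim hC τ + extDim hC ω)) {i : ι}
    (hi : i ∈ Q.orbit (Q.tgt e)) :
    blockT (extDim hC τ (Q.orb i)) (extDim hC ω (Q.orb i)) (extDim hC τ (Q.orb i))
      (extDim hC ω (Q.orb i)) (legMat hC (ν := τ + ω) x hi) = legMat hC (partT x) hi :=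
  blockT_castM (extDim_tgt_leg hC τ hi) (extDim_tgt_leg hC ω hi) (extDim_leg hC τ hi)
    (extDim_leg hC ω hi) _ _ _ (RingHom.id K)

theorem blockW_legMat (x : Q.RepSpace K (extDim hC τ + extDim hC ω)) {i : ι}
    (hi : i ∈ Q.orbit (Q.tgt e)) :
    blockW (extDim hC τ (Q.orb i)) (extDim hC ω (Q.orb i)) (extDim hC τ (Q.orb i))
      (extDim hC ω (Q.orb i)) (legMat hC (ν := τ + ω) x hi) = legMat hC (partW x) hi :=
  blockW_castM (extDim_tgt_leg hC τ hi) (extDim_tgt_leg hC ω hi) (extDim_leg hC τ hi)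
    (extDim_leg hC ω hi) _ _ _ (RingHom.id K)

theorem LeavesW.mem_heart_iff {x : Q.RepSpace K (extDim hC τ + extDim hC ω)} (hx : LeavesW x) :
    x ∈ heart e (extDim hC τ + extDim hC ω) ↔
      partT x ∈ heart e (extDim hC τ) ∧ partW x ∈ heart e (extDim hC ω) := by
  refine (AdmissibleQuiver.mem_heart_iff hC (ν := τ + ω)).trans ?_
  rw [AdmissibleQuiver.mem_heart_iff hC, AdmissibleQuiver.mem_heart_iff hC]
  simp only [← blockT_legMat, ← blockW_legMat, ← forall_and]
  exact forall₂_congr fun i hi => (mapsW_legMat hC hx hi).isUnit_iff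

theorem exists_parabolic_smul_inflateSum_eq {x : Q.RepSpace K (extDim hC τ + extDim hC ω)}
    (hx : x ∈ heart e (extDim hC τ + extDim hC ω)) (hW : LeavesW x) :
    ∃ t ∈ parabolic K (extDim hC τ) (extDim hC ω), ∃ y : (contract hC).RepSpace K (τ + ω),
      t • inflateSum hC y = x := by
  refine ⟨legGrp hC (ν := τ + ω) hx, mem_parabolic_iff.2 fun i => ?_, _,
    legGrp_smul_inflate hC (ν := τ + ω) hx⟩
  by_cases hi : i ∈ Q.orbit (Q.tgt e)
  · exact (legGrp_of_mem hC (ν := τ + ω) hx hi).symm ▸ mapsW_legMat hC hW hi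
  · exact (legGrp_of_notMem hC (ν := τ + ω) hx hi).symm ▸ mapsW_one _ _

end inflateSum

section inflateE

variable {ι Ω : Type*} {Q : AdmissibleQuiver ι Ω} [Finite ι] [Finite Ω] {e : Ω}
variable (hC : Q.IsContractible e) {K : Type*} [Field K] (φ : K →+* K)
variable {τ ω : (contract hC).Dim}

/-- The inflation of pairs `(g, x) ∈ G_V̂ × S_Ŵ`. -/
def inflatePair (z : (contract hC).Grp K (τ + ω) × StabSpace K τ ω) :
    Q.Grp K (extDim hC τ + extDim hC ω) × StabSpace K (extDim hC τ) (extDim hC ω) :=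
  (diagSum hC z.1, ⟨inflateSum hC z.2.1, (leavesW_inflateSum_iff hC).2 z.2.2⟩)

/-- The inflation `Ê' → E'`, `[g, x] ↦ [diag g, inflate x]`. -/
def inflateE' : EPrime K τ ω → EPrime K (extDim hC τ) (extDim hC ω) :=
  Quotient.map (inflatePair hC) fun z _ ⟨b, hb, h1, h2⟩ =>
    ⟨diagSum hC b, diagSum_mem_unipotent hC hb, by simp [inflatePair, h1],
      (congrArg (inflateSum hC) h2).trans (inflateSum_smul hC b z.2.1)⟩

/-- The inflation `Ê'' → E''`, `[g, x] ↦ [diag g, inflate x]`. -/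
def inflateE'' : EDoublePrime K τ ω → EDoublePrime K (extDim hC τ) (extDim hC ω) :=
  Quotient.map (inflatePair hC) fun z _ ⟨b, hb, h1, h2⟩ =>
    ⟨diagSum hC b, (diagSum_mem_parabolic_iff hC).2 hb, by simp [inflatePair, h1],
      (congrArg (inflateSum hC) h2).trans (inflateSum_smul hC b z.2.1)⟩

theorem p₁T_inflateE' (z : EPrime K τ ω) : p₁T (inflateE' hC z) = inflate hC (p₁T z) := by
  obtain ⟨z, rfl⟩ := Quotient.exists_rep z
  exact partT_inflateSum hC z.2.1

theorem p₁W_inflateE' (z : EPrime K τ ω) : p₁W (inflateE' hC z) = inflate hC (p₁W z) := by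
  obtain ⟨z, rfl⟩ := Quotient.exists_rep z
  exact partW_inflateSum hC z.2.1

theorem p₂_inflateE' (z : EPrime K τ ω) : p₂ (inflateE' hC z) = inflateE'' hC (p₂ z) := by
  obtain ⟨z, rfl⟩ := Quotient.exists_rep z
  rfl

theorem p₃_inflateE'' (w : EDoublePrime K τ ω) :
    p₃ (inflateE'' hC w) = inflateSum hC (p₃ w) := by
  obtain ⟨z, rfl⟩ := Quotient.exists_rep w
  exact (inflateSum_smul hC z.1 z.2.1).symm

theorem inflatePair_frob (z : (contract hC).Grp K (τ + ω) × StabSpace K τ ω) :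
    inflatePair hC (frobG φ z.1, frobS φ z.2) =
      (frobG φ (inflatePair hC z).1, frobS φ (inflatePair hC z).2) :=
  Prod.ext (diagSum_frobG hC φ z.1) (Subtype.ext (inflateSum_frob hC φ z.2.1))

theorem inflateE'_semiconj :
    Function.Semiconj (inflateE' (K := K) (τ := τ) (ω := ω) hC) (frobE' φ) (frobE' φ) := fun z => by
  obtain ⟨z, rfl⟩ := Quotient.exists_rep z
  exact congrArg (Quotient.mk _) (inflatePair_frob hC φ z)

theorem inflateE''_semiconj :
    Function.Semiconj (inflateE'' (K := K) (τ := τ) (ω := ω) hC) (frobE'' φ) (frobE'' φ) :=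
  fun w => by
    obtain ⟨z, rfl⟩ := Quotient.exists_rep w
    exact congrArg (Quotient.mk _) (inflatePair_frob hC φ z)

theorem inflateE'_smul (l : (contract hC).Grp K τ × (contract hC).Grp K ω) (z : EPrime K τ ω) :
    inflateE' hC (l • z) = (diag hC l.1, diag hC l.2) • inflateE' hC z := by
  obtain ⟨z, rfl⟩ := Quotient.exists_rep z
  refine congrArg (Quotient.mk _) (Prod.ext ?_ (Subtype.ext ?_))
  · exact (map_mul _ _ _).trans (congrArg _ (map_inv _ _))
  · exact inflateSum_smul hC (levi l).1 z.2.1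

theorem inflateE''_injective : Function.Injective (inflateE'' (K := K) (τ := τ) (ω := ω) hC) := by
  rintro ⟨z⟩ ⟨z'⟩ h
  obtain ⟨b, hb, h1, h2⟩ := Quotient.exact h
  obtain ⟨b, rfl⟩ := exists_diagSum_eq_of_smul_inflateSum_eq hC h2.symm
  refine Quotient.sound ⟨b, (diagSum_mem_parabolic_iff hC).1 hb, diagSum_injective hC ?_,
    inflateSum_injective hC ?_⟩
  · rw [map_mul, map_inv]
    exact h1
  · rw [inflateSum_smul]
    exact h2

theorem exists_inflateE''_eq {w : EDoublePrime K (extDim hC τ) (extDim hC ω)}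
    {x : (contract hC).RepSpace K (τ + ω)} (h : p₃ w = inflateSum hC x) :
    ∃ w', inflateE'' hC w' = w := by
  obtain ⟨⟨g, y, hy⟩, rfl⟩ := Quotient.exists_rep w
  change g • y = inflateSum hC x at h
  have hy' : y ∈ heart e (extDim hC τ + extDim hC ω) := by
    rw [← inv_smul_eq_iff.2 h.symm]
    exact smul_mem_heart _ (inflateSum_mem_heart hC x)
  obtain ⟨t, ht, y', rfl⟩ := exists_parabolic_smul_inflateSum_eq hC hy' hy
  have hW : LeavesW (inflateSum hC y') := by
    rw [← inv_smul_smul t (inflateSum hC y')]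
    exact LeavesW.smul (inv_mem ht) hy
  rw [← mul_smul] at h
  obtain ⟨g', hg'⟩ := exists_diagSum_eq_of_smul_inflateSum_eq hC h
  exact ⟨Quotient.mk _ (g', ⟨y', (leavesW_inflateSum_iff hC).1 hW⟩), Quotient.sound
    ⟨t, ht, eq_mul_inv_of_mul_eq hg'.symm, rfl⟩⟩

theorem eq_of_smul_inflateE'_eq
    {k k' : Q.Grp K (extDim hC τ) × Q.Grp K (extDim hC ω)} {z z' : EPrime K τ ω}
    (hk : (projHom hC).prodMap (projHom hC) k = 1) (hk' : (projHom hC).prodMap (projHom hC) k' = 1)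
    (h : k • inflateE' hC z = k' • inflateE' hC z') : k = k' ∧ z = z' := by
  have hp : p₂ z = p₂ z' := inflateE''_injective hC <| by
    rw [← p₂_inflateE', ← p₂_inflateE', ← p₂_smul k, ← p₂_smul k' (inflateE' hC z'), h]
  obtain ⟨l, rfl⟩ := exists_smul_eq_of_p₂_eq hp
  rw [inflateE'_smul, ← mul_smul] at h
  obtain rfl := smul_left_injective_EPrime _ h
  have hl : l = 1 := by
    rw [map_mul, hk', one_mul] at hk
    exact (Prod.ext (projHom_diag hC l.1).symm (projHom_diag hC l.2).symm).trans hk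
  subst hl
  exact ⟨mul_one k', (one_smul _ z).symm⟩

theorem exists_smul_inflateE'_eq {z : EPrime K (extDim hC τ) (extDim hC ω)}
    {w : EDoublePrime K τ ω} (h : p₂ z = inflateE'' hC w) :
    ∃ (k : Q.Grp K (extDim hC τ) × Q.Grp K (extDim hC ω)) (z' : EPrime K τ ω),
      (projHom hC).prodMap (projHom hC) k = 1 ∧ p₂ z' = w ∧ k • inflateE' hC z' = z := by
  obtain ⟨z', rfl⟩ := p₂_surjective w
  rw [← p₂_inflateE'] at h
  obtain ⟨l, rfl⟩ := exists_smul_eq_of_p₂_eq h.symm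
  let l' := (projHom hC).prodMap (projHom hC) l
  refine ⟨l * (diag hC l'.1, diag hC l'.2)⁻¹, l' • z', ?_, p₂_smul _ _, ?_⟩
  · rw [map_mul, map_inv, mul_inv_eq_one]
    exact Prod.ext (projHom_diag hC l'.1).symm (projHom_diag hC l'.2).symm
  · rw [inflateE'_smul, ← mul_smul, inv_mul_cancel_right]

end inflateE

section pushforward

variable {L X Y X' Y' M : Type*} [AddCommMonoid M]

theorem finsum_comp_fst (u : X → M) : ∑ᶠ z : X × L, u z.1 = Nat.card L • ∑ᶠ x, u x := by
  obtain hL | hL := isEmpty_or_nonempty L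
  · rw [finsum_of_isEmpty, Nat.card_of_isEmpty, zero_smul]
  obtain _ | hL := finite_or_infinite L
  · have := Fintype.ofFinite L
    by_cases hu : (Function.support u).Finite
    · rw [finsum_curry _ ((hu.prod Set.finite_univ).subset fun _ hz => ⟨hz, trivial⟩)]
      simp only [finsum_eq_sum_of_fintype, Finset.sum_const, Finset.card_univ,
        Nat.card_eq_fintype_card]
      exact (smul_finsum' _ hu).symm
    · rw [finsum_of_infinite_support hu, finsum_of_infinite_support, smul_zero]
      exact fun h => hu ((h.image Prod.fst).subset fun x hx => ⟨(x, hL.some), hx, rfl⟩)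
  · rw [Nat.card_eq_zero_of_infinite, zero_smul]
    by_cases hu : ∀ x, u x = 0
    · simp only [hu, finsum_zero]
    obtain ⟨x, hx⟩ := not_forall.1 hu
    exact finsum_of_infinite_support
      (Set.infinite_of_injective_forall_mem (Prod.mk_right_injective x) fun _ => hx)

theorem pushforward_comp_fst (f : X → Y) (u : X → M) (y : Y) :
    pushforward (fun z : X × L => f z.1) (fun z => u z.1) y = Nat.card L • pushforward f u y := by
  let E : {z : X × L // f z.1 = y} ≃ {x : X // f x = y} × L :=
    Equiv.prodSubtypeFstEquivSubtypeProd (p := fun x => f x = y)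
  exact (finsum_comp_equiv E (f := fun z => u z.1.1)).trans
    (finsum_comp_fst fun x : {x // f x = y} => u x.1)

theorem pushforward_const_mul {R : Type*} [NonUnitalNonAssocSemiring R] [NoZeroDivisors R]
    (f : X → Y) (c : R) (u : X → R) (y : Y) :
    pushforward f (fun x => c * u x) y = c * pushforward f u y :=
  (mul_finsum _ c).symm

theorem pushforward_apply_of_injective {f : X → Y} {f' : X' → Y'} {m : X' → X} {n : Y' → Y}
    (hm : Function.Injective m) (hn : Function.Injective n) (hf : ∀ x, f (m x) = n (f' x))
    (u : X → M) {y : Y'} (hy : ∀ x, f x = n y → ∃ x', m x' = x) :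
    pushforward f u (n y) = pushforward f' (u ∘ m) y := by
  let m' : {x // f' x = y} → {x // f x = n y} := fun x => ⟨m x, (hf x).trans (congrArg n x.2)⟩
  refine (finsum_comp (g := fun x : {x // f x = n y} => u x) m' ⟨fun x x' h => ?_, ?_⟩).symm
  · exact Subtype.ext (hm (congrArg Subtype.val h))
  · rintro ⟨x, hx⟩
    obtain ⟨x', rfl⟩ := hy x hx
    exact ⟨⟨x', hn ((hf x').symm.trans hx)⟩, rfl⟩

end pushforward

section fixedPoints

/-- If `π : G → H` has a section `σ` and both commute with endomorphisms `F` of `G` and `F'` of `H`,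
then `G^F` is the product of `H^F'` and the `F`-fixed part of the kernel of `π`. -/
def fixedPointsEquivProd {G H : Type*} [Group G] [Group H] {F : G →* G} {F' : H →* H}
    (π : G →* H) (σ : H →* G) (hσ : ∀ h, π (σ h) = h) (hπF : Function.Semiconj π F F')
    (hσF : Function.Semiconj σ F' F) :
    Function.fixedPoints F ≃ Function.fixedPoints F' × {k : Function.fixedPoints F // π k = 1} where
  toFun g := (fixMap π hπF g, ⟨⟨(σ (π g))⁻¹ * g, by
    have hg : F g = g := g.2
    change F ((σ (π g))⁻¹ * g) = (σ (π g))⁻¹ * g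
    rw [map_mul, map_inv, ← hσF, ← hπF, hg]⟩, by
    rw [map_mul, map_inv, hσ, inv_mul_cancel]⟩)
  invFun z := ⟨σ z.1 * z.2, by
    have hh : F' z.1 = z.1 := z.1.2
    have hk : F z.2 = z.2 := z.2.1.2
    change F (σ z.1 * z.2) = σ z.1 * z.2
    rw [map_mul, ← hσF, hh, hk]⟩
  left_inv g := Subtype.ext (mul_inv_cancel_left _ _)
  right_inv z := by
    have hπ : π (σ z.1 * z.2) = z.1 := by rw [map_mul, hσ, z.2.2, mul_one]
    refine Prod.ext (Subtype.ext hπ) (Subtype.ext (Subtype.ext ?_))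
    change (σ (π (σ z.1 * z.2)))⁻¹ * (σ z.1 * z.2) = z.2
    rw [hπ, inv_mul_cancel_left]

variable {ι Ω : Type*} {Q : AdmissibleQuiver ι Ω} [Finite ι] [Finite Ω] {e : Ω}
variable (hC : Q.IsContractible e) {K : Type*} [Field K] (φ : K →+* K)

/-- The `F`-fixed part of the kernel of the projection `G_V → G_V̂`. -/
abbrev KerF (ν : (contract hC).Dim) : Type _ :=
  {k : GrpF (Q := Q) φ (extDim hC ν) // projHom hC k.1 = 1}

theorem card_grpF_extDim (ν : (contract hC).Dim) : Nat.card (GrpF (Q := Q) φ (extDim hC ν)) =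
    Nat.card (GrpF (Q := contract hC) φ ν) * Nat.card (KerF hC φ ν) := by
  rw [← Nat.card_prod]
  exact Nat.card_congr (fixedPointsEquivProd (projHom hC) (diag hC) (projHom_diag hC)
    (projHom_frobG hC φ) (diag_frobG hC φ))

/-- Inflation of `F`-fixed representations. -/
def inflateF {ν : (contract hC).Dim} :
    RepF (Q := contract hC) (K := K) φ ν → RepF (Q := Q) φ (extDim hC ν) :=
  fixMap (inflate hC) (inflate_frob hC φ)

variable {τ ω : (contract hC).Dim}

/-- `inflateF` on `T̂ ⊕ Ŵ`, with values in the representations on `T ⊕ W`. -/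
def inflateSumF : RepF (Q := contract hC) (K := K) φ (τ + ω) →
    RepF (Q := Q) φ (extDim hC τ + extDim hC ω) :=
  fixMap (inflateSum hC) (inflateSum_frob hC φ)

/-- The inflation `Ê''^F → E''^F`. -/
def inflateE''F : Function.fixedPoints (frobE'' (K := K) (τ := τ) (ω := ω) φ) →
    Function.fixedPoints (frobE'' (K := K) (τ := extDim hC τ) (ω := extDim hC ω) φ) :=
  fixMap (inflateE'' hC) (inflateE''_semiconj hC φ)

theorem fixMap_injective {X Y : Type*} {F : X → X} {F' : Y → Y} {f : X → Y}
    {hf : Function.Semiconj f F F'} (h : Function.Injective f) :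
    Function.Injective (fixMap f hf) := fun _ _ hx => Subtype.ext (h (congrArg Subtype.val hx))

/-- The pair of automorphisms underlying a pair in `KerF`. -/
def kerPair (k : KerF hC φ τ × KerF hC φ ω) :
    Q.Grp K (extDim hC τ) × Q.Grp K (extDim hC ω) :=
  (k.1.1.1, k.2.1.1)

theorem projHom_kerPair (k : KerF hC φ τ × KerF hC φ ω) :
    (projHom hC).prodMap (projHom hC) (kerPair hC φ k) = 1 :=
  Prod.ext k.1.2 k.2.2

theorem kerPair_injective : Function.Injective (kerPair (τ := τ) (ω := ω) hC φ) := fun _ _ h =>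
  Prod.ext (Subtype.ext (Subtype.ext (congrArg Prod.fst h)))
    (Subtype.ext (Subtype.ext (congrArg Prod.snd h)))

/-- `(z, k) ↦ k • inflateE' z` on `F`-fixed points. It identifies `Ê'^F × Ker^F` with the preimage
of `Ê''^F` in `E'^F`. -/
def kerSMulInflateE'F
    (y : Function.fixedPoints (frobE' (K := K) (τ := τ) (ω := ω) φ) ×
      (KerF hC φ τ × KerF hC φ ω)) :
    Function.fixedPoints (frobE' (K := K) (τ := extDim hC τ) (ω := extDim hC ω) φ) :=
  ⟨kerPair hC φ y.2 • inflateE' hC y.1.1, by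
    have hk : (frobG φ (kerPair hC φ y.2).1, frobG φ (kerPair hC φ y.2).2) = kerPair hC φ y.2 :=
      Prod.ext y.2.1.1.2 y.2.2.1.2
    have hz : frobE' φ y.1.1 = y.1.1 := y.1.2
    change frobE' φ (_ • _) = _ • _
    rw [frobE'_smul, ← inflateE'_semiconj hC φ, hk, hz]⟩

theorem kerSMulInflateE'F_injective :
    Function.Injective (kerSMulInflateE'F (τ := τ) (ω := ω) hC φ) := fun y y' h => by
  obtain ⟨hk, hz⟩ := eq_of_smul_inflateE'_eq hC (projHom_kerPair hC φ y.2)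
    (projHom_kerPair hC φ y'.2) (congrArg Subtype.val h)
  exact Prod.ext (Subtype.ext hz) (kerPair_injective hC φ hk)

theorem exists_kerSMulInflateE'F_eq
    {z : Function.fixedPoints (frobE' (K := K) (τ := extDim hC τ) (ω := extDim hC ω) φ)}
    {w : EDoublePrime K τ ω} (h : p₂ z.1 = inflateE'' hC w) :
    ∃ y, kerSMulInflateE'F hC φ y = z := by
  obtain ⟨k, z', hk, -, hz'⟩ := exists_smul_inflateE'_eq hC h
  have hF : (frobG φ k.1, frobG φ k.2) • inflateE' hC (frobE' φ z') = k • inflateE' hC z' := by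
    rw [inflateE'_semiconj, ← frobE'_smul, hz']
    exact z.2
  have hFk : (projHom hC).prodMap (projHom hC) (frobG φ k.1, frobG φ k.2) = 1 := by
    refine Prod.ext ?_ ?_
    · exact (projHom_frobG hC φ k.1).trans
        ((congrArg _ (congrArg Prod.fst hk)).trans (map_one _))
    · exact (projHom_frobG hC φ k.2).trans
        ((congrArg _ (congrArg Prod.snd hk)).trans (map_one _))
  obtain ⟨hkF, hzF⟩ := eq_of_smul_inflateE'_eq hC hFk hk hF
  exact ⟨(⟨z', hzF⟩, (⟨⟨k.1, congrArg Prod.fst hkF⟩, congrArg Prod.fst hk⟩,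
    ⟨⟨k.2, congrArg Prod.snd hkF⟩, congrArg Prod.snd hk⟩)), Subtype.ext hz'⟩

theorem exists_inflateE''F_eq
    {w : Function.fixedPoints (frobE'' (K := K) (τ := extDim hC τ) (ω := extDim hC ω) φ)}
    {x : (contract hC).RepSpace K (τ + ω)} (h : p₃ w.1 = inflateSum hC x) :
    ∃ w', inflateE''F hC φ w' = w := by
  obtain ⟨w', hw'⟩ := exists_inflateE''_eq hC h
  refine ⟨⟨w', inflateE''_injective hC ?_⟩, Subtype.ext hw'⟩
  rw [inflateE''_semiconj, hw']
  exact w.2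

end fixedPoints

section psiHom

variable {ι Ω : Type*} {Q : AdmissibleQuiver ι Ω} [Finite ι] [Finite Ω] {e : Ω}
variable (hC : Q.IsContractible e) {K : Type*} [Field K] (φ : K →+* K)
variable {R : Type*} [Field R] (s : R)

/-- The scalar `(q^{-1/2})^{ν_{i₋}² φ}` in the definition of `μ_ν^⋆`. -/
def muScalar (ν : (contract hC).Dim) : R :=
  s⁻¹ ^ (extDim hC ν (Q.orb (Q.tgt e)) ^ 2 * Q.φ₁ (Q.tgt e))

/-- The component `(j_ν)_! ∘ μ_ν^⋆ : H_ν̂ → H_ν` of `ψ`. -/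
def psiHom (ν : (contract hC).Dim) :
    hallSpace (Q := contract hC) φ R ν →ₗ[R] hallSpace (Q := Q) φ R (extDim hC ν) :=
  jShriek hC φ R ν ∘ₗ muStar hC φ s ν

variable {ν : (contract hC).Dim} (f : hallSpace (Q := contract hC) φ R ν)

theorem psiHom_apply_of_mem_heart {x : RepF (Q := Q) φ (extDim hC ν)}
    (hx : x.1 ∈ heart e (extDim hC ν)) :
    (psiHom hC φ s ν f).1 x = muScalar hC s ν * f.1 (mu hC φ ν ⟨x, hx⟩) :=
  dif_pos hx

theorem psiHom_apply_of_notMem_heart {x : RepF (Q := Q) φ (extDim hC ν)}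
    (hx : x.1 ∉ heart e (extDim hC ν)) : (psiHom hC φ s ν f).1 x = 0 :=
  dif_neg hx

theorem psiHom_apply_of_smul_inflate_eq {k : Q.Grp K (extDim hC ν)} (hk : projHom hC k = 1)
    {x : RepF (Q := Q) φ (extDim hC ν)} {y : RepF (Q := contract hC) φ ν}
    (hx : k • inflate hC y.1 = x.1) : (psiHom hC φ s ν f).1 x = muScalar hC s ν * f.1 y := by
  have hheart : x.1 ∈ heart e (extDim hC ν) := hx ▸ smul_mem_heart k (inflate_mem_heart hC y.1)
  have hmu : mu hC φ ν ⟨x, hheart⟩ = y := Subtype.ext <| by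
    change contractMap hC x.1 = y.1
    rw [← hx, contractMap_smul, contractMap_inflate]
    exact (congrArg (· • y.1) hk).trans (one_smul _ _)
  rw [psiHom_apply_of_mem_heart hC φ s f hheart, hmu]

theorem psiHom_inflateF (y : RepF (Q := contract hC) φ ν) :
    (psiHom hC φ s ν f).1 (inflateF hC φ y) = muScalar hC s ν * f.1 y :=
  psiHom_apply_of_smul_inflate_eq hC φ s f (map_one _) (one_smul _ _)

variable {s}

theorem muScalar_ne_zero (hs : s ≠ 0) : muScalar hC s ν ≠ 0 :=
  pow_ne_zero _ (inv_ne_zero hs)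

theorem psiHom_injective (hs : s ≠ 0) : Function.Injective (psiHom hC φ s ν) := fun f g h => by
  refine Subtype.ext (funext fun y => mul_left_cancel₀ (muScalar_ne_zero hC (ν := ν) hs) ?_)
  rw [← psiHom_inflateF, h, psiHom_inflateF]

end psiHom

section rawInd

variable {ι Ω : Type*} {Q : AdmissibleQuiver ι Ω} [Finite ι] [Finite Ω] {e : Ω}
variable (hC : Q.IsContractible e) {K : Type*} [Field K] (φ : K →+* K)
variable {R : Type*} [Field R] {τ ω : (contract hC).Dim}

theorem pushforward_p₃_inflateSumF
    (u : Function.fixedPoints (frobE'' (K := K) (τ := extDim hC τ) (ω := extDim hC ω) φ) → R)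
    (x : RepF (Q := contract hC) φ (τ + ω)) :
    pushforward (fixMap p₃ (p₃_semiconj φ)) u (inflateSumF hC φ x) =
      pushforward (fixMap p₃ (p₃_semiconj φ)) (u ∘ inflateE''F hC φ) x :=
  pushforward_apply_of_injective (fixMap_injective (inflateE''_injective hC))
    (fixMap_injective (inflateSum_injective hC)) (fun w => Subtype.ext (p₃_inflateE'' hC w.1)) u
    fun _ hw => exists_inflateE''F_eq hC φ (congrArg Subtype.val hw)

theorem p₂_kerSMulInflateE'F (y : Function.fixedPoints (frobE' (K := K) (τ := τ) (ω := ω) φ) ×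
      (KerF hC φ τ × KerF hC φ ω)) :
    fixMap p₂ (p₂_semiconj φ) (kerSMulInflateE'F hC φ y) =
      inflateE''F hC φ (fixMap p₂ (p₂_semiconj φ) y.1) :=
  Subtype.ext ((p₂_smul _ _).trans (p₂_inflateE' hC y.1.1))

theorem pushforward_p₂_inflateE''F
    (u : Function.fixedPoints (frobE' (K := K) (τ := extDim hC τ) (ω := extDim hC ω) φ) → R)
    (w : Function.fixedPoints (frobE'' (K := K) (τ := τ) (ω := ω) φ)) :
    pushforward (fixMap p₂ (p₂_semiconj φ)) u (inflateE''F hC φ w) =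
      pushforward (fun y => fixMap p₂ (p₂_semiconj φ) y.1) (u ∘ kerSMulInflateE'F hC φ) w :=
  pushforward_apply_of_injective (kerSMulInflateE'F_injective hC φ)
    (fixMap_injective (inflateE''_injective hC)) (p₂_kerSMulInflateE'F hC φ) u
    fun _ hz => exists_kerSMulInflateE'F_eq hC φ (congrArg Subtype.val hz)

variable (s : R) (f : hallSpace (Q := contract hC) φ R τ) (g : hallSpace (Q := contract hC) φ R ω)

theorem psiHom_p₁T_kerSMulInflateE'F
    (y : Function.fixedPoints (frobE' (K := K) (τ := τ) (ω := ω) φ) ×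
      (KerF hC φ τ × KerF hC φ ω)) :
    (psiHom hC φ s τ f).1 (fixMap p₁T (p₁T_semiconj φ) (kerSMulInflateE'F hC φ y)) =
      muScalar hC s τ * f.1 (fixMap p₁T (p₁T_semiconj φ) y.1) := by
  refine psiHom_apply_of_smul_inflate_eq hC φ s f y.2.1.2 ?_
  change _ = p₁T (kerPair hC φ y.2 • inflateE' hC y.1.1)
  rw [p₁T_smul, p₁T_inflateE']
  rfl

theorem psiHom_p₁W_kerSMulInflateE'F
    (y : Function.fixedPoints (frobE' (K := K) (τ := τ) (ω := ω) φ) ×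
      (KerF hC φ τ × KerF hC φ ω)) :
    (psiHom hC φ s ω g).1 (fixMap p₁W (p₁W_semiconj φ) (kerSMulInflateE'F hC φ y)) =
      muScalar hC s ω * g.1 (fixMap p₁W (p₁W_semiconj φ) y.1) := by
  refine psiHom_apply_of_smul_inflate_eq hC φ s g y.2.2.2 ?_
  change _ = p₁W (kerPair hC φ y.2 • inflateE' hC y.1.1)
  rw [p₁W_smul, p₁W_inflateE']
  rfl

theorem rawInd_psiHom_inflateSumF (x : RepF (Q := contract hC) φ (τ + ω)) :
    rawInd φ (psiHom hC φ s τ f).1 (psiHom hC φ s ω g).1 (inflateSumF hC φ x) =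
      Nat.card (KerF hC φ τ) * Nat.card (KerF hC φ ω) * (muScalar hC s τ * muScalar hC s ω) *
        rawInd φ f.1 g.1 x := by
  rw [rawInd, pushforward_p₃_inflateSumF, rawInd, ← pushforward_const_mul]
  congr 1
  funext w
  rw [Function.comp_apply, pushforward_p₂_inflateE''F, ← Nat.cast_mul, ← Nat.card_prod, mul_assoc,
    ← nsmul_eq_mul, ← pushforward_const_mul, ← pushforward_comp_fst]
  congr 1
  funext y
  rw [Function.comp_apply, psiHom_p₁T_kerSMulInflateE'F, psiHom_p₁W_kerSMulInflateE'F,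
    mul_mul_mul_comm]

variable {φ} in
theorem rawInd_eq_zero_of_notMem_heart {f : RepF (Q := Q) φ (extDim hC τ) → R}
    {g : RepF (Q := Q) φ (extDim hC ω) → R} (hf : ∀ y, y.1 ∉ heart e (extDim hC τ) → f y = 0)
    (hg : ∀ y, y.1 ∉ heart e (extDim hC ω) → g y = 0)
    {x : RepF (Q := Q) φ (extDim hC τ + extDim hC ω)}
    (hx : x.1 ∉ heart e (extDim hC τ + extDim hC ω)) : rawInd φ f g x = 0 := by
  have hp₁ : ∀ z : EPrime K (extDim hC τ) (extDim hC ω),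
      p₃ (p₂ z) ∉ heart e (extDim hC τ + extDim hC ω) →
        p₁T z ∉ heart e (extDim hC τ) ∨ p₁W z ∉ heart e (extDim hC ω) := by
    rintro ⟨a, y, hy⟩ hz
    exact not_and_or.1 fun h => hz (smul_mem_heart a ((LeavesW.mem_heart_iff hC hy).2 h))
  refine finsum_eq_zero_of_forall_eq_zero fun w => finsum_eq_zero_of_forall_eq_zero fun z => ?_
  have hzw : p₂ z.1.1 = w.1.1 := congrArg Subtype.val z.2
  have hz : p₃ (p₂ z.1.1) = x.1 := (congrArg p₃ hzw).trans (congrArg Subtype.val w.2)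
  obtain h | h := hp₁ z.1.1 (hz ▸ hx)
  · exact mul_eq_zero_of_left (hf _ h) _
  · exact mul_eq_zero_of_right _ (hg _ h)

end rawInd

section exponents

variable {ι Ω : Type*} {Q : AdmissibleQuiver ι Ω}

theorem orb_eq_of_mem_orbit {i j : ι} (hi : i ∈ Q.orbit j) : Q.orb i = Q.orb j :=
  Quotient.sound hi.symm

variable [Finite ι] [Finite Ω] {e : Ω} (hC : Q.IsContractible e)

theorem finsum_comp_fold {M : Type*} [AddCommMonoid M] (f : Q.CVertex e → M) :
    ∑ᶠ i : ι, f (fold hC i) = ∑ᶠ i, f i +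
      ∑ᶠ i : {i // i ∈ Q.orbit (Q.tgt e)}, f (fold hC i.1) := by
  classical
  have := Fintype.ofFinite ι
  simp only [finsum_eq_sum_of_fintype]
  rw [← Fintype.sum_subtype_add_sum_subtype (fun i => i ∉ Q.orbit (Q.tgt e))]
  congr 1
  · exact Finset.sum_congr rfl fun i _ => by rw [fold_eq]
  · exact Fintype.sum_equiv (Equiv.subtypeEquivRight fun i => not_not) _ _ fun i => rfl

theorem orb_fold {i j : ι} (hi : i ∈ Q.orbit j) :
    (contract hC).orb (fold hC i) = (contract hC).orb (fold hC j) :=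
  congrArg (foldOrb hC) (orb_eq_of_mem_orbit hi)

include hC in
theorem card_sameCycle :
    Nat.card {h : Ω // Q.aE.SameCycle e h} = Q.φ₁ (Q.tgt e) :=
  Nat.card_congr (Equiv.ofBijective (fun h => ⟨Q.tgt h.1, tgt_mem h.2⟩)
    ⟨fun h h' heq => Subtype.ext (hC.eq_of_tgt h.2 h'.2 (congrArg Subtype.val heq)),
      fun i => ⟨⟨Q.leg e i.2, Q.leg_sameCycle e i.2⟩, Subtype.ext (Q.tgt_leg e i.2)⟩⟩)

theorem finsum_vertex_extDim_mul (τ ω : (contract hC).Dim) :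
    ∑ᶠ i : ι, extDim hC τ (Q.orb i) * extDim hC ω (Q.orb i) =
      ∑ᶠ i, τ ((contract hC).orb i) * ω ((contract hC).orb i) +
        Q.φ₁ (Q.tgt e) * (extDim hC τ (Q.orb (Q.tgt e)) * extDim hC ω (Q.orb (Q.tgt e))) := by
  classical
  have := Fintype.ofFinite ι
  refine (finsum_comp_fold hC fun i => τ ((contract hC).orb i) * ω ((contract hC).orb i)).trans ?_
  congr 1
  have hconst (i : {i // i ∈ Q.orbit (Q.tgt e)}) :
      τ ((contract hC).orb (fold hC i.1)) * ω ((contract hC).orb (fold hC i.1)) =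
        extDim hC τ (Q.orb (Q.tgt e)) * extDim hC ω (Q.orb (Q.tgt e)) := by
    rw [orb_fold hC i.2, extDim_orb, extDim_orb]
  rw [finsum_congr hconst, finsum_eq_sum_of_fintype, Finset.sum_const, smul_eq_mul,
    Finset.card_univ, φ₁, Nat.card_eq_fintype_card]

theorem finsum_edge_extDim_mul (τ ω : (contract hC).Dim) :
    ∑ᶠ h : Ω, extDim hC τ (Q.orb (Q.src h)) * extDim hC ω (Q.orb (Q.tgt h)) =
      ∑ᶠ h : Q.CEdge e, τ ((contract hC).orb ((contract hC).src h)) *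
        ω ((contract hC).orb ((contract hC).tgt h)) +
      Q.φ₁ (Q.tgt e) * (extDim hC τ (Q.orb (Q.tgt e)) * extDim hC ω (Q.orb (Q.tgt e))) := by
  classical
  have := Fintype.ofFinite Ω
  have hconst (h : {h // Q.aE.SameCycle e h}) :
      extDim hC τ (Q.orb (Q.src h.1)) * extDim hC ω (Q.orb (Q.tgt h.1)) =
        extDim hC τ (Q.orb (Q.tgt e)) * extDim hC ω (Q.orb (Q.tgt e)) := by
    rw [← extDim_tgt_eq_src hC τ h.2, orb_eq_of_mem_orbit (tgt_mem h.2)]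
  rw [finsum_eq_sum_of_fintype, finsum_eq_sum_of_fintype,
    ← Fintype.sum_subtype_add_sum_subtype (fun h => Q.aE.SameCycle e h), add_comm]
  congr 1
  rw [Fintype.sum_congr _ _ hconst, Finset.sum_const, smul_eq_mul, Finset.card_univ,
    ← Nat.card_eq_fintype_card, card_sameCycle hC]

theorem mExp_extDim (τ ω : (contract hC).Dim) :
    mExp (extDim hC τ) (extDim hC ω) = mExp τ ω +
      2 * (Q.φ₁ (Q.tgt e) * (extDim hC τ (Q.orb (Q.tgt e)) * extDim hC ω (Q.orb (Q.tgt e)))) := by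
  rw [mExp, mExp, finsum_vertex_extDim_mul, finsum_edge_extDim_mul]
  ring

theorem muScalar_add_mul {R : Type*} [Field R] {s : R} (hs : s ≠ 0) (τ ω : (contract hC).Dim) :
    muScalar hC s (τ + ω) * (s ^ mExp τ ω)⁻¹ =
      (s ^ mExp (extDim hC τ) (extDim hC ω))⁻¹ * (muScalar hC s τ * muScalar hC s ω) := by
  have hadd : extDim hC (τ + ω) (Q.orb (Q.tgt e)) =
    extDim hC τ (Q.orb (Q.tgt e)) + extDim hC ω (Q.orb (Q.tgt e)) := rfl
  rw [muScalar, muScalar, muScalar, mExp_extDim, hadd, inv_pow, inv_pow, inv_pow]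
  field_simp
  ring

end exponents

section ind

variable {ι Ω : Type*} {Q : AdmissibleQuiver ι Ω}
variable {K : Type*} [Field K] (φ : K →+* K) {R : Type*} [Field R] (s : R)

theorem ind_apply {τ ω : Q.Dim} (f : hallSpace (Q := Q) φ R τ) (g : hallSpace (Q := Q) φ R ω)
    (x : RepF (Q := Q) φ (τ + ω)) : (ind φ s f g).1 x = (s ^ mExp τ ω)⁻¹ *
      (Nat.card (GrpF (Q := Q) φ τ × GrpF (Q := Q) φ ω) : R)⁻¹ * rawInd φ f.1 g.1 x := rfl

theorem ind_zero_left {τ ω : Q.Dim} (g : hallSpace (Q := Q) φ R ω) :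
    ind φ s (0 : hallSpace (Q := Q) φ R τ) g = 0 := Subtype.ext <| funext fun x => by
  have h : rawInd φ (0 : hallSpace (Q := Q) φ R τ).1 g.1 x = 0 :=
    finsum_eq_zero_of_forall_eq_zero fun _ => finsum_eq_zero_of_forall_eq_zero fun _ =>
      zero_mul _
  rw [ind_apply, h, mul_zero]
  rfl

theorem ind_zero_right {τ ω : Q.Dim} (f : hallSpace (Q := Q) φ R τ) :
    ind φ s f (0 : hallSpace (Q := Q) φ R ω) = 0 := Subtype.ext <| funext fun x => by
  have h : rawInd φ f.1 (0 : hallSpace (Q := Q) φ R ω).1 x = 0 :=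
    finsum_eq_zero_of_forall_eq_zero fun _ => finsum_eq_zero_of_forall_eq_zero fun _ =>
      mul_zero _
  rw [ind_apply, h, mul_zero]
  rfl

variable [Finite ι] [Finite Ω] {e : Ω} (hC : Q.IsContractible e) {τ ω : (contract hC).Dim}

theorem card_kerF_ne_zero [Finite (GrpF (Q := Q) φ (extDim hC τ))] :
    Nat.card (KerF hC φ τ) ≠ 0 := by
  have h : Nat.card (GrpF (Q := Q) φ (extDim hC τ)) ≠ 0 :=
    Nat.card_ne_zero.2 ⟨⟨⟨1, map_one (frobG φ)⟩⟩, inferInstance⟩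
  rw [card_grpF_extDim] at h
  exact right_ne_zero_of_mul h

theorem rawInd_psiHom_of_mem_heart (f : hallSpace (Q := contract hC) φ R τ)
    (g : hallSpace (Q := contract hC) φ R ω) {x : RepF (Q := Q) φ (extDim hC (τ + ω))}
    (hx : x.1 ∈ heart e (extDim hC (τ + ω))) :
    rawInd φ (psiHom hC φ s τ f).1 (psiHom hC φ s ω g).1 x =
      Nat.card (KerF hC φ τ) * Nat.card (KerF hC φ ω) * (muScalar hC s τ * muScalar hC s ω) *
        rawInd φ f.1 g.1 (mu hC φ (τ + ω) ⟨x, hx⟩) := by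
  rw [← rawInd_psiHom_inflateSumF]
  exact rawInd_mem φ _ _ ⟨legGrp hC hx, frobG_legGrp hC φ hx x.2⟩
    (inflateSumF hC φ (mu hC φ (τ + ω) ⟨x, hx⟩)) x (legGrp_smul_inflate hC hx)

variable {s}

theorem psiHom_ind [CharZero R] (hs : s ≠ 0) [∀ ν, Finite (GrpF (Q := Q) φ ν)]
    (f : hallSpace (Q := contract hC) φ R τ) (g : hallSpace (Q := contract hC) φ R ω) :
    psiHom hC φ s (τ + ω) (ind φ s f g) = ind φ s (psiHom hC φ s τ f) (psiHom hC φ s ω g) := by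
  refine Subtype.ext (funext fun x => ?_)
  refine Eq.trans ?_ (ind_apply φ s (psiHom hC φ s τ f) (psiHom hC φ s ω g) x).symm
  by_cases hx : x.1 ∈ heart e (extDim hC (τ + ω))
  · have hτ : (Nat.card (KerF hC φ τ) : R) ≠ 0 := Nat.cast_ne_zero.2 (card_kerF_ne_zero φ hC)
    have hω : (Nat.card (KerF hC φ ω) : R) ≠ 0 := Nat.cast_ne_zero.2 (card_kerF_ne_zero φ hC)
    rw [psiHom_apply_of_mem_heart hC φ s _ hx, ind_apply, rawInd_psiHom_of_mem_heart φ s hC f g hx,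
      Nat.card_prod, Nat.card_prod, card_grpF_extDim, card_grpF_extDim, ← mul_assoc, ← mul_assoc,
      muScalar_add_mul hC hs]
    push_cast
    field_simp
  · rw [psiHom_apply_of_notMem_heart hC φ s _ hx, rawInd_eq_zero_of_notMem_heart hC
      (fun y hy => psiHom_apply_of_notMem_heart hC φ s f hy)
      (fun y hy => psiHom_apply_of_notMem_heart hC φ s g hy) hx, mul_zero]

end ind

section hallAlgebra

variable {ι Ω : Type*} {Q : AdmissibleQuiver ι Ω} {K : Type*} [Field K] (φ : K →+* K)
variable {R : Type*} [Field R] (s : R)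

theorem hallAlgebra_induction {p : Q.HallAlgebra φ s → Prop} (f : Q.HallAlgebra φ s) (h0 : p 0)
    (hof : ∀ ν x, p (Q.hallOf φ s ν x)) (hadd : ∀ x y, p x → p y → p (x + y)) : p f := by
  classical
  exact DirectSum.induction_on (motive := p) f h0 hof hadd

theorem hallComponent_hallOf_self (ν : Q.Dim) (x : hallSpace (Q := Q) φ R ν) :
    Q.hallComponent φ s ν (Q.hallOf φ s ν x) = x := by
  classical
  exact DirectSum.component.lof_self R (M := fun ν => hallSpace (Q := Q) φ R ν) ν x

theorem hallComponent_hallOf_of_ne {ν ν' : Q.Dim} (h : ν ≠ ν')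
    (x : hallSpace (Q := Q) φ R ν) : Q.hallComponent φ s ν' (Q.hallOf φ s ν x) = 0 := by
  classical
  exact (DirectSum.component.of R (M := fun ν => hallSpace (Q := Q) φ R ν) ν' ν x).trans (dif_neg h)

theorem hallAlgebra_ext {f g : Q.HallAlgebra φ s}
    (h : ∀ ν, Q.hallComponent φ s ν f = Q.hallComponent φ s ν g) : f = g :=
  DFinsupp.ext h

theorem mem_hallSupport {f : Q.HallAlgebra φ s} {ν : Q.Dim} :
    ν ∈ Q.hallSupport φ s f ↔ Q.hallComponent φ s ν f ≠ 0 := by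
  classical
  exact DFinsupp.mem_support_iff

theorem hallAlgebra_mul_def (f g : Q.HallAlgebra φ s) :
    f * g = ∑ τ ∈ Q.hallSupport φ s f, ∑ ω ∈ Q.hallSupport φ s g,
      Q.hallOf φ s (τ + ω) (ind φ s (Q.hallComponent φ s τ f) (Q.hallComponent φ s ω g)) := rfl

theorem hallAlgebra_mul_eq_sum {f g : Q.HallAlgebra φ s} {S T : Finset Q.Dim}
    (hS : Q.hallSupport φ s f ⊆ S) (hT : Q.hallSupport φ s g ⊆ T) :
    f * g = ∑ τ ∈ S, ∑ ω ∈ T,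
      Q.hallOf φ s (τ + ω) (ind φ s (Q.hallComponent φ s τ f) (Q.hallComponent φ s ω g)) := by
  rw [hallAlgebra_mul_def]
  refine Eq.trans (Finset.sum_congr rfl fun τ _ => Finset.sum_subset hT fun ω _ hω => ?_)
    (Finset.sum_subset hS fun τ _ hτ => Finset.sum_eq_zero fun ω _ => ?_)
  · rw [mem_hallSupport, not_not] at hω
    rw [hω, ind_zero_right, map_zero]
  · rw [mem_hallSupport, not_not] at hτ
    rw [hτ, ind_zero_left, map_zero]

end hallAlgebra

section psi

variable {ι Ω : Type*} {Q : AdmissibleQuiver ι Ω} [Finite ι] [Finite Ω] {e : Ω}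
variable (hC : Q.IsContractible e) {K : Type*} [Field K] (φ : K →+* K)
variable {R : Type*} [Field R] (s : R)

theorem psi_hallOf (ν : (contract hC).Dim) (f : hallSpace (Q := contract hC) φ R ν) :
    psi hC φ s ((contract hC).hallOf φ s ν f) =
      Q.hallOf φ s (extDim hC ν) (psiHom hC φ s ν f) := by
  classical
  have hstar : muStarHall hC φ s ((contract hC).hallOf φ s ν f) =
      DirectSum.lof R _ (fun ν => heartSpace hC φ R ν) ν (muStar hC φ s ν f) :=
    DirectSum.lmap_lof (fun ν => muStar hC φ s ν) ν f
  rw [psi, LinearMap.comp_apply, hstar]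
  exact DirectSum.toModule_lof R ν _

theorem extDim_injective : Function.Injective (extDim hC) := fun ν ν' h => by
  funext i
  obtain ⟨i, rfl⟩ := Quotient.exists_rep i
  have := congrFun h (Q.orb i.1)
  rwa [← extDim_val, ← extDim_val] at this

theorem hallComponent_psi (ν : (contract hC).Dim) (f : (contract hC).HallAlgebra φ s) :
    Q.hallComponent φ s (extDim hC ν) (psi hC φ s f) =
      psiHom hC φ s ν ((contract hC).hallComponent φ s ν f) := by
  refine hallAlgebra_induction φ s (p := fun f => Q.hallComponent φ s (extDim hC ν) (psi hC φ s f) =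
    psiHom hC φ s ν ((contract hC).hallComponent φ s ν f)) f (by simp) (fun ν' x => ?_)
    fun x y hx hy => by simp only [map_add, hx, hy]
  rw [psi_hallOf]
  by_cases h : ν' = ν
  · subst h
    rw [hallComponent_hallOf_self, hallComponent_hallOf_self]
  · rw [hallComponent_hallOf_of_ne φ s h, map_zero,
      hallComponent_hallOf_of_ne φ s (fun h' => h (extDim_injective hC h'))]

theorem hallComponent_psi_of_notMem {ν : Q.Dim} (hν : ν ∉ Set.range (extDim hC))
    (f : (contract hC).HallAlgebra φ s) : Q.hallComponent φ s ν (psi hC φ s f) = 0 := by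
  refine hallAlgebra_induction φ s (p := fun f => Q.hallComponent φ s ν (psi hC φ s f) = 0) f
    (by simp) (fun ν' x => ?_) fun x y hx hy => by simp only [map_add, hx, hy, add_zero]
  rw [psi_hallOf, hallComponent_hallOf_of_ne φ s (fun h => hν ⟨ν', h⟩)]

theorem psi_injective (hs : s ≠ 0) : Function.Injective (psi hC φ s) := fun f g h =>
  hallAlgebra_ext φ s fun ν => psiHom_injective hC φ hs (by
    rw [← hallComponent_psi, ← hallComponent_psi, h])

theorem mem_heart_extDim_zero (x : Q.RepSpace K (extDim hC 0)) : x ∈ heart e (extDim hC 0) :=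
  fun h _ =>
    have : Subsingleton (Fin (extDim hC 0 (Q.orb (Q.src h))) → K) :=
      inferInstanceAs (Subsingleton (Fin 0 → K))
    have : Subsingleton (Fin (extDim hC 0 (Q.orb (Q.tgt h))) → K) :=
      inferInstanceAs (Subsingleton (Fin 0 → K))
    ⟨Function.injective_of_subsingleton _, fun _ => ⟨0, Subsingleton.elim _ _⟩⟩

theorem muScalar_zero : muScalar hC s 0 = 1 := by
  have h : extDim hC 0 (Q.orb (Q.tgt e)) = 0 := rfl
  rw [muScalar, h, zero_pow two_ne_zero, zero_mul, pow_zero]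

theorem psi_one : psi hC φ s 1 = 1 :=
  (psi_hallOf hC φ s 0 _).trans <| congrArg (Q.hallOf φ s 0) <| Subtype.ext <| funext fun x =>
    (psiHom_apply_of_mem_heart hC φ s _ (x := x) (mem_heart_extDim_zero hC x.1)).trans <|
      (mul_one _).trans (muScalar_zero hC s)

open Classical in
theorem hallSupport_psi_subset (f : (contract hC).HallAlgebra φ s) :
    Q.hallSupport φ s (psi hC φ s f) ⊆
      ((contract hC).hallSupport φ s f).image (extDim hC) := fun ν hν => by
  rw [mem_hallSupport] at hν
  by_cases h : ν ∈ Set.range (extDim hC)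
  · obtain ⟨ν, rfl⟩ := h
    refine Finset.mem_image_of_mem _ ((mem_hallSupport φ s).2 fun h0 => hν ?_)
    rw [hallComponent_psi, h0, map_zero]
  · exact absurd (hallComponent_psi_of_notMem hC φ s h f) hν

theorem psi_mul [CharZero R] (hs : s ≠ 0) [∀ ν, Finite (GrpF (Q := Q) φ ν)]
    (f g : (contract hC).HallAlgebra φ s) :
    psi hC φ s (f * g) = psi hC φ s f * psi hC φ s g := by
  classical
  rw [hallAlgebra_mul_eq_sum φ s (hallSupport_psi_subset hC φ s f)
      (hallSupport_psi_subset hC φ s g),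
    Finset.sum_image (extDim_injective hC).injOn, hallAlgebra_mul_def, map_sum]
  refine Finset.sum_congr rfl fun τ _ => ?_
  rw [Finset.sum_image (extDim_injective hC).injOn, map_sum]
  refine Finset.sum_congr rfl fun ω _ => ?_
  rw [psi_hallOf, hallComponent_psi, hallComponent_psi]
  exact congrArg (Q.hallOf φ s (extDim hC τ + extDim hC ω)) (psiHom_ind φ hC hs _ _)

end psi

section finiteness

variable {ι Ω : Type*} {Q : AdmissibleQuiver ι Ω} {K : Type*} [Field K] (φ : K →+* K)

theorem orb_pow_aV (k : ℕ) (i : ι) : Q.orb ((Q.aV ^ k) i) = Q.orb i := by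
  induction k with
  | zero => rfl
  | succ k ih => rw [pow_succ', Equiv.Perm.mul_apply, orb_aV, ih]

theorem apply_eq_castM_map_pow {ν : Q.Dim} {g : Q.Grp K ν} (hg : frobG φ g = g) (k : ℕ) {i j : ι}
    (hij : (Q.aV ^ k) i = j) (h : ν (Q.orb i) = ν (Q.orb j)) :
    (g i).1 = castM h h ((g j).1.map (φ ^ k)) := by
  induction k generalizing j with
  | zero =>
    subst hij
    rfl
  | succ k ih =>
    subst hij
    have hstep : castM _ _ ((g (Q.aV ((Q.aV ^ k) i))).1.map φ) = (g ((Q.aV ^ k) i)).1 :=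
      congrArg Units.val (congrFun hg ((Q.aV ^ k) i))
    have hcomp : ((φ ^ k : K →+* K) : K → K) ∘ φ = (φ ^ (k + 1) : K →+* K) := by
      rw [pow_succ]
      rfl
    rw [ih rfl (by rw [orb_pow_aV]), ← hstep, castM_map, castM_castM, Matrix.map_map, hcomp]
    exact castM_family (fun i => (g i).1.map (φ ^ (k + 1)))
      (by rw [pow_succ', Equiv.Perm.mul_apply]) _ _ _ _

theorem pow_orderOf_apply_entry {ν : Q.Dim} {g : Q.Grp K ν} (hg : frobG φ g = g) (i : ι)
    (r c : Fin (ν (Q.orb i))) : (φ ^ orderOf Q.aV) ((g i).1 r c) = (g i).1 r c := by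
  have h := apply_eq_castM_map_pow φ hg (orderOf Q.aV) (i := i) (j := i)
    (by rw [pow_orderOf_eq_one, Equiv.Perm.one_apply]) rfl
  exact (congrFun (congrFun h r) c).symm

variable {φ}

theorem finite_grpF [Finite ι] (hφ : {x : K | (φ ^ orderOf Q.aV) x = x}.Finite) (ν : Q.Dim) :
    Finite (GrpF (Q := Q) φ ν) := by
  have := hφ.to_subtype
  let entries (g : GrpF (Q := Q) φ ν) (i : ι) (r c : Fin (ν (Q.orb i))) :
      {x : K | (φ ^ orderOf Q.aV) x = x} :=
    ⟨(g.1 i).1 r c, pow_orderOf_apply_entry φ g.2 i r c⟩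
  refine Finite.of_injective entries fun g g' h => Subtype.ext (funext fun i => Units.ext ?_)
  ext r c
  exact congrArg Subtype.val (congrFun (congrFun (congrFun h i) r) c)

end finiteness

end AdmissibleQuiver

theorem finite_fixed_Fr_pow (p : ℕ) [Fact p.Prime] {n d : ℕ} (hn : 0 < n) (hd : 0 < d) :
    {x : AlgebraicClosure (ZMod p) | (Fr p n ^ d) x = x}.Finite := by
  have hp : 1 < p := (Fact.out : p.Prime).one_lt
  have h0 : (Polynomial.X ^ p ^ (n * d) - Polynomial.X :
      Polynomial (AlgebraicClosure (ZMod p))) ≠ 0 :=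
    FiniteField.X_pow_card_pow_sub_X_ne_zero _ (Nat.mul_pos hn hd).ne' hp
  refine (Polynomial.finite_setOfPred_isRoot h0).subset fun x hx => ?_
  have hpow : (Fr p n ^ d) x = x ^ p ^ (n * d) := by
    rw [Fr, iterateFrobenius_eq_pow, ← pow_mul, ← iterateFrobenius_eq_pow, iterateFrobenius_def]
  have hfix : x ^ p ^ (n * d) = x := hpow.symm.trans hx
  simp [Polynomial.IsRoot, hfix]

theorem root_ne_zero {s : ℂ} (hs : s ≠ 0) : root s ≠ 0 := fun h => hs <| by
  rw [← IntermediateField.AdjoinSimple.algebraMap_gen ℚ s]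
  exact (congrArg _ h).trans (map_zero _)

end HallContraction

end

open HallContraction AdmissibleQuiver in
theorem mainTheorem1_general {ι Ω : Type*} [Finite ι] [Finite Ω] (Q : AdmissibleQuiver ι Ω) (e : Ω)
    (hC : Q.IsContractible e) {K : Type*} [Field K] (φ : K →+* K)
    (hφ : {x : K | (φ ^ orderOf Q.aV) x = x}.Finite)
    {R : Type*} [Field R] [CharZero R] {s : R} (hs : s ≠ 0) :
    Function.Injective (psi hC φ s) ∧ psi hC φ s 1 = 1 ∧
      ∀ f g : (contract hC).HallAlgebra φ s, psi hC φ s (f * g) = psi hC φ s f * psi hC φ s g :=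
  have := finite_grpF (Q := Q) hφ
  ⟨psi_injective hC φ s hs, psi_one hC φ s, psi_mul hC φ s hs⟩

theorem mainTheorem1 {ι Ω : Type*} [Finite ι] [Finite Ω]
    (Q : HallContraction.AdmissibleQuiver ι Ω) (e : Ω) (hC : Q.IsContractible e)
    (p : ℕ) [Fact p.Prime] (n : ℕ) (hn : 0 < n) (s : ℂ) (hs : s ^ 2 = (p : ℂ) ^ n) :
    Function.Injective (HallContraction.AdmissibleQuiver.psi hC (HallContraction.Fr p n)
      (HallContraction.root s)) ∧
    HallContraction.AdmissibleQuiver.psi hC (HallContraction.Fr p n) (HallContraction.root s) 1 = 1 ∧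
    ∀ f g : (HallContraction.AdmissibleQuiver.contract hC).HallAlgebra (HallContraction.Fr p n)
        (HallContraction.root s),
      HallContraction.AdmissibleQuiver.psi hC (HallContraction.Fr p n) (HallContraction.root s)
          (f * g) =
        HallContraction.AdmissibleQuiver.psi hC (HallContraction.Fr p n) (HallContraction.root s) f *
        HallContraction.AdmissibleQuiver.psi hC (HallContraction.Fr p n) (HallContraction.root s) g
    := by
  have hs0 : s ≠ 0 :=
    ne_zero_pow two_ne_zero (hs ▸ pow_ne_zero n (Nat.cast_ne_zero.2 (NeZero.ne p)))
  exact mainTheorem1_general Q e hC _ (HallContraction.finite_fixed_Fr_pow p hn (orderOf_pos Q.aV))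
    (HallContraction.root_ne_zero hs0)
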